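/- Let $n\ge 2$ and $j\ge 1$ be integers, let $\mathcal S^n\subset\mathbb R^{n+1}$ be the unit sphere with its rotation-invariant surface measure $d\sigma$ and $\Sigma_n=\int_{\mathcal S^n}d\sigma=\frac{2\pi^{(n+1)/2}}{\Gamma((n+1)/2)}$, and put $\langle f,g\rangle=\frac1{\Sigma_n}\int_{\mathcal S^n}\overline{f}\,g\,d\sigma$. Spherical coordinates $(\vartheta_1,\dots,\vartheta_{n-1},\varphi)$ are given by $x_i=\sin\vartheta_1\cdots\sin\vartheta_{i-1}\cos\vartheta_i$ for $1\le i\le n-1$, $x_n=\sin\vartheta_1\cdots\sin\vartheta_{n-1}\cos\varphi$, $x_{n+1}=\sin\vartheta_1\cdots\sin\vartheta_{n-1}\sin\varphi$. Let $\mathcal H_l$ be the space of restrictions to $\mathcal S^n$ of the complex harmonic homogeneous polynomials of degree $l$ on $\mathbb R^{n+1}$, and $$\mathcal V_j=\bigoplus_{l=0}^{2^{j-1}-1}\mathcal H_l .$$ Let $I_j$ be the set of all $(l,k)$ with $l\in\{0,\dots,2^{j-1}-1\}$ and $k=(k_1,\dots,k_{n-2},\pm k_{n-1})$, where $k_1,\dots,k_{n-1}$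 are integers with $l=k_0\ge k_1\ge\dots\ge k_{n-1}\ge0$. For such $(l,k)$ let $$Y_l^k(x)=A_l^k\prod_{\nu=1}^{n-1}C_{k_{\nu-1}-k_\nu}^{\frac{n-\nu}2+k_\nu}(\cos\vartheta_\nu)\,\sin^{k_\nu}\vartheta_\nu\cdot e^{\pm ik_{n-1}\varphi},$$ where $C_m^\lambda$ are the Gegenbauer polynomials, $\sum_{m\ge0}C_m^\lambda(t)r^m=(1-2tr+r^2)^{-\lambda}$, and $A_l^k>0$ is such that $\langle Y_l^k,Y_l^k\rangle=1$. Let $a_l^k(f)=\langle Y_l^k,f\rangle$ be the Fourier coefficients of $f$. For integers $\alpha\ge1$ and $0\le u\le M$, $M=2^j$, let $\epsilon_0=\epsilon_M=\frac12$, $\epsilon_u=1$ otherwise, and define the generalized Clenshaw–Curtis weights $$\chi_u^{(j,\alpha)}=\epsilon_u\cdot\frac{\pi\,\alpha!}{2^{\alpha-1}M}\sum_{\mu=0}^{\lfloor M/2\rfloor}\frac{\epsilon_{2\mu}(-1)^\mu\cos\frac{2\mu u\pi}{M}}{\Gamma(\frac\alpha2-\mu+1)\,\Gamma(\frac\alpha2+\mu+1)},$$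 where a summand is $0$ if $\frac\alpha2-\mu+1\in\{0,-1,-2,\dots\}$. Let $\mathcal N_j$ be the set of all $(s,t)=(s_1,\dots,s_{n-1},t)$ with $s_\nu\in\{0,\dots,2^j\}$ and $t\in\{0,\dots,2^{j+1}-1\}$, and let $x_{s,t}^j\in\mathcal S^n$ be the point with spherical coordinates $\left(\frac{s_1\pi}{2^j},\dots,\frac{s_{n-1}\pi}{2^j},\frac{t\pi}{2^j}\right)$. Then for all $f\in\mathcal V_j$ and all $(l,k)\in I_j$, $$a_l^k(f)=\frac{\pi}{2^j\,\Sigma_n}\sum_{(s,t)\in\mathcal N_j}\left(\prod_{\nu=1}^{n-1}\chi_{s_\nu}^{(j,\,n-\nu)}\right)f(x_{s,t}^j)\,\overline{Y_l^k(x_{s,t}^j)} .$$ -/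

import Mathlib

open scoped ComplexConjugate

noncomputable section

namespace SphereSampling

/-- The unit sphere of dimension `n` in Euclidean space of dimension `n + 1`. -/
abbrev Sphere (n : ℕ) : Type := Metric.sphere (0 : EuclideanSpace ℝ (Fin (n + 1))) 1

/-- The (non-normalized) rotation invariant surface measure on the sphere. -/
def surfaceMeasure (n : ℕ) : MeasureTheory.Measure (Sphere n) :=
  (MeasureTheory.volume : MeasureTheory.Measure (EuclideanSpace ℝ (Fin (n + 1)))).toSphere

/-- The total surface area `Σ_n = ∫ dσ` of the sphere. -/
def sphereArea (n : ℕ) : ℝ := ∫ _x : Sphere n, (1 : ℝ) ∂(surfaceMeasure n)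

/-- The closed form `Σ_n = 2 π ^ (λ + 1) / Γ (λ + 1)` with `λ = (n - 1) / 2`. -/
theorem sphereArea_eq (n : ℕ) :
    sphereArea n =
      2 * Real.pi ^ (((n : ℝ) - 1) / 2 + 1) / Real.Gamma (((n : ℝ) - 1) / 2 + 1) := by
  have e : ((n : ℝ) - 1) / 2 + 1 = ((n : ℝ) + 1) / 2 := by ring
  have hp : 0 < ((n : ℝ) + 1) / 2 := by positivity
  have hG := Real.Gamma_add_one hp.ne'
  have hGp := Real.Gamma_pos_of_pos hp
  rw [e, sphereArea, MeasureTheory.integral_const, smul_eq_mul, mul_one, surfaceMeasure,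
    MeasureTheory.Measure.toSphere_real_apply_univ, MeasureTheory.measureReal_def,
    EuclideanSpace.volume_ball]
  simp only [finrank_euclideanSpace, Fintype.card_fin, ENNReal.ofReal_one, one_pow, one_mul]
  rw [ENNReal.toReal_ofReal (by positivity)]
  push_cast
  rw [hG, Real.sqrt_eq_rpow, ← Real.rpow_natCast, ← Real.rpow_mul Real.pi_pos.le]
  push_cast
  rw [show (1 : ℝ) / 2 * ((n : ℝ) + 1) = ((n : ℝ) + 1) / 2 by ring]
  field_simp

/-- The Gegenbauer polynomial `C_l^lam`, evaluated at `t`, in its explicit form; by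
`hasSum_gegenbauer` below these are the coefficients of the generating function. -/
def gegenbauer (l : ℕ) (lam t : ℝ) : ℝ :=
  ∑ m ∈ Finset.range (l / 2 + 1),
    (-1) ^ m * (ascPochhammer ℝ (l - m)).eval lam
      / ((m.factorial : ℝ) * ((l - 2 * m).factorial : ℝ)) * (2 * t) ^ (l - 2 * m)

theorem hasSum_ascPochhammer (a : ℝ) {x : ℝ} (hx : |x| < 1) :
    HasSum (fun m : ℕ => (ascPochhammer ℝ m).eval a / (m.factorial : ℝ) * x ^ m)
      ((1 - x) ^ (-a)) := by
  have h := (Real.one_div_one_sub_rpow_hasFPowerSeriesOnBall_zero a).hasSum (y := x)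
    (by simpa [enorm_eq_nnnorm, ← NNReal.coe_lt_coe] using hx)
  have h1 : (0 : ℝ) ≤ 1 - x := by linarith [(abs_lt.1 hx).2]
  rw [Real.rpow_neg h1, ← one_div]
  simp only [zero_add, FormalMultilinearSeries.ofScalars_apply_eq, smul_eq_mul] at h
  have hfun : (fun m : ℕ => (ascPochhammer ℝ m).eval a / (m.factorial : ℝ) * x ^ m) =
      fun m : ℕ => Ring.choose (a + m - 1) m * x ^ m := ?_
  · rw [hfun]; exact h
  funext m
  rw [Ring.choose_eq_smul, Polynomial.descPochhammer_smeval_eq_ascPochhammer,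
    Polynomial.ascPochhammer_smeval_eq_eval, smul_eq_mul,
    show a + (m : ℝ) - 1 - m + 1 = a by ring]
  ring

/-- The generating function `∑ C_l^lam (t) r ^ l = (1 - 2 t r + r ^ 2) ^ (-lam)` of the Gegenbauer
polynomials. -/
theorem hasSum_gegenbauer (lam t r : ℝ) (hr : |2 * t * r| + r ^ 2 < 1) :
    HasSum (fun l : ℕ => gegenbauer l lam t * r ^ l) ((1 - 2 * t * r + r ^ 2) ^ (-lam)) := by
  set c : ℕ → ℝ := fun m => (ascPochhammer ℝ m).eval lam / (m.factorial : ℝ) with hc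
  set F : ℕ × ℕ → ℝ := fun p =>
    c (p.1 + p.2) * ((p.1 + p.2).choose p.1) * (2 * t * r) ^ p.1 * (- r ^ 2) ^ p.2 with hF
  have hb : ∀ (u v : ℝ) (m : ℕ), ∑ p ∈ Finset.HasAntidiagonal.antidiagonal m,
      c (p.1 + p.2) * ((p.1 + p.2).choose p.1) * u ^ p.1 * v ^ p.2 = c m * (u + v) ^ m := by
    intro u v m
    rw [(Commute.all u v).add_pow', Finset.mul_sum]
    refine Finset.sum_congr rfl fun p hp => ?_
    rw [Finset.HasAntidiagonal.mem_antidiagonal.1 hp, nsmul_eq_mul]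
    ring
  have hsF : Summable F := by
    have habs : Summable fun m => |c m| * (|2 * t * r| + r ^ 2) ^ m := by
      have hx : |(|2 * t * r| + r ^ 2)| < 1 := by rwa [abs_of_nonneg (by positivity)]
      have := (hasSum_ascPochhammer lam hx).summable.abs
      refine this.congr fun m => ?_
      rw [abs_mul, abs_pow, abs_of_nonneg (show 0 ≤ |2 * t * r| + r ^ 2 by positivity)]
    rw [← summable_abs_iff, ← Finset.HasAntidiagonal.sigmaAntidiagonalEquivProd.summable_iff]
    refine (summable_sigma_of_nonneg (fun _ => abs_nonneg _)).2 ⟨fun m => Summable.of_finite, ?_⟩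
    refine habs.congr fun m => ?_
    rw [tsum_fintype, (Commute.all |2 * t * r| (r ^ 2)).add_pow', Finset.mul_sum,
      ← Finset.sum_coe_sort]
    refine Finset.sum_congr rfl fun p _ => ?_
    have hp := Finset.HasAntidiagonal.mem_antidiagonal.1 p.2
    simp only [hF, Finset.HasAntidiagonal.sigmaAntidiagonalEquivProd_apply, hp]
    simp only [abs_mul, abs_pow, abs_neg, Nat.abs_cast, nsmul_eq_mul, sq_abs]
    ring
  have hval : HasSum F ((1 - 2 * t * r + r ^ 2) ^ (-lam)) := by
    have hx : |2 * t * r + - r ^ 2| < 1 := by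
      refine (abs_add_le _ _).trans_lt ?_
      rwa [abs_neg, abs_of_nonneg (sq_nonneg r)]
    have h1 := hasSum_ascPochhammer lam hx
    have h2 := (Finset.HasAntidiagonal.sigmaAntidiagonalEquivProd.hasSum_iff.2 hsF.hasSum).sigma
      (fun m => hasSum_fintype _)
    have h3 : (fun m : ℕ => c m * (2 * t * r + - r ^ 2) ^ m) = fun m =>
        ∑ p : Finset.HasAntidiagonal.antidiagonal m,
          (F ∘ Finset.HasAntidiagonal.sigmaAntidiagonalEquivProd) ⟨m, p⟩ := by
      funext m
      rw [← hb, ← Finset.sum_coe_sort]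
      rfl
    rw [← h3] at h2
    rw [show 1 - 2 * t * r + r ^ 2 = 1 - (2 * t * r + - r ^ 2) by ring, h1.unique h2]
    exact hsF.hasSum
  have h4 := hval.tsum_fiberwise (fun p : ℕ × ℕ => p.1 + 2 * p.2)
  have hfun : (fun l : ℕ => gegenbauer l lam t * r ^ l) =
      fun l : ℕ => ∑' p : (fun p : ℕ × ℕ => p.1 + 2 * p.2) ⁻¹' {l}, F p := ?_
  · rw [hfun]; exact h4
  funext l
  have hset : (fun p : ℕ × ℕ => p.1 + 2 * p.2) ⁻¹' {l} =
      (((Finset.range (l / 2 + 1)).image fun m => (l - 2 * m, m) : Finset (ℕ × ℕ)) :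
        Set (ℕ × ℕ)) := by
    ext ⟨p, q⟩
    simp only [Set.mem_preimage, Set.mem_singleton_iff, Finset.coe_image, Set.mem_image,
      Finset.mem_coe, Finset.mem_range, Prod.mk.injEq]
    constructor
    · intro h
      exact ⟨q, by omega, by omega, rfl⟩
    · rintro ⟨m, h1, h2, rfl⟩
      omega
  rw [hset, Finset.tsum_subtype', Finset.sum_image (fun a _ b _ h => (Prod.mk.inj h).2),
    gegenbauer, Finset.sum_mul]
  refine Finset.sum_congr rfl fun m hm => ?_
  have hm' : 2 * m ≤ l := by have := Finset.mem_range.1 hm; omega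
  obtain ⟨d, rfl⟩ := Nat.exists_eq_add_of_le hm'
  have e1 : 2 * m + d - 2 * m = d := by omega
  have e2 : 2 * m + d - m = d + m := by omega
  simp only [hF, hc, e1, e2]
  have hch : (((d + m).choose d : ℕ) : ℝ) * (d.factorial * m.factorial) = (d + m).factorial := by
    exact_mod_cast by rw [← mul_assoc, Nat.choose_symm_add]; exact Nat.add_choose_mul_factorial_mul_factorial d m
  have h1 : (d.factorial : ℝ) ≠ 0 := by positivity
  have h2 : (m.factorial : ℝ) ≠ 0 := by positivity
  have h3 : ((d + m).factorial : ℝ) ≠ 0 := by positivity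
  rw [neg_pow (r ^ 2) m]
  field_simp
  rw [← hch]
  ring

/-- The Laplace operator on complex polynomials in `n + 1` variables. -/
def laplacian (n : ℕ) :
    MvPolynomial (Fin (n + 1)) ℂ →ₗ[ℂ] MvPolynomial (Fin (n + 1)) ℂ :=
  ∑ i : Fin (n + 1),
    (MvPolynomial.pderiv i).toLinearMap ∘ₗ (MvPolynomial.pderiv i).toLinearMap

/-- Restriction of a complex polynomial in `n + 1` real variables to the sphere. -/
def restrictToSphere (n : ℕ) : MvPolynomial (Fin (n + 1)) ℂ →ₗ[ℂ] (Sphere n → ℂ) :=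
  LinearMap.pi fun x =>
    (MvPolynomial.aeval (R := ℂ) fun i : Fin (n + 1) => ((x.1 i : ℝ) : ℂ)).toLinearMap

/-- `H_l`: the hyperspherical harmonics of degree `l`, that is, the restrictions to the sphere of
the harmonic polynomials that are homogeneous of degree `l`. -/
def harmonicSpace (n l : ℕ) : Submodule ℂ (Sphere n → ℂ) :=
  (MvPolynomial.homogeneousSubmodule (Fin (n + 1)) ℂ l ⊓ LinearMap.ker (laplacian n)).map
    (restrictToSphere n)

/-- The sampling space `V_j`: the sum of the spaces `H_l` over `l = 0, …, 2 ^ (j - 1) - 1`. -/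
def samplingSpace (n j : ℕ) : Submodule ℂ (Sphere n → ℂ) :=
  ⨆ l ∈ Finset.range (2 ^ (j - 1)), harmonicSpace n l

/-! ### Spherical coordinates

The colatitudes are `ϑ_1, …, ϑ_{n-1}`; `ϑ_ν` is stored at the index `ν - 1` of `Fin (n - 1)`. -/

/-- The Cartesian coordinates of the point with spherical coordinates `(ϑ_1, …, ϑ_{n-1}, φ)`. -/
def sphericalVector {n : ℕ} (ϑ : Fin (n - 1) → ℝ) (φ : ℝ) : EuclideanSpace ℝ (Fin (n + 1)) :=
  WithLp.toLp 2 fun i : Fin (n + 1) =>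
    (∏ m : Fin (n - 1) with m.val < i.val, Real.sin (ϑ m)) *
      (if h : (i : ℕ) < n - 1 then Real.cos (ϑ ⟨i, h⟩)
        else if (i : ℕ) = n - 1 then Real.cos φ else Real.sin φ)

theorem sum_sin_cos (a : ℕ → ℝ) (d : ℕ) :
    (∑ i ∈ Finset.range d, ((∏ m ∈ Finset.range i, Real.sin (a m)) * Real.cos (a i)) ^ 2) +
      (∏ m ∈ Finset.range d, Real.sin (a m)) ^ 2 = 1 := by
  induction d with
  | zero => simp
  | succ d ih =>
    rw [Finset.sum_range_succ, Finset.prod_range_succ, ← ih]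
    linear_combination
      (∏ m ∈ Finset.range d, Real.sin (a m)) ^ 2 * Real.sin_sq_add_cos_sq (a d)

theorem sphericalVector_mem {n : ℕ} (hn : 2 ≤ n) (ϑ : Fin (n - 1) → ℝ) (φ : ℝ) :
    sphericalVector ϑ φ ∈ Metric.sphere (0 : EuclideanSpace ℝ (Fin (n + 1))) 1 := by
  obtain ⟨d, rfl⟩ : ∃ d, n = d + 1 := ⟨n - 1, by omega⟩
  set a : ℕ → ℝ := fun m => if h : m < d + 1 - 1 then ϑ ⟨m, h⟩ else 0 with ha
  have hprod : ∀ i ≤ d,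
      (∏ m : Fin (d + 1 - 1) with m.val < i, Real.sin (ϑ m)) =
        ∏ m ∈ Finset.range i, Real.sin (a m) := by
    intro i hi
    refine Finset.prod_bij (fun m _ => (m : ℕ)) ?_ ?_ ?_ ?_
    · intro m hm; simpa using hm
    · intro m _ m' _ h; exact Fin.ext h
    · intro m hm
      have : m < d + 1 - 1 := by have := Finset.mem_range.1 hm; omega
      exact ⟨⟨m, this⟩, by simpa using hm, rfl⟩
    · intro m _; simp [ha]
  have hall : (∏ m : Fin (d + 1 - 1) with m.val < d + 1, Real.sin (ϑ m)) =
        ∏ m ∈ Finset.range d, Real.sin (a m) := by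
    rw [← hprod d le_rfl]
    refine Finset.prod_congr (Finset.filter_congr fun m _ => ?_) fun _ _ => rfl
    have := m.2; omega
  rw [mem_sphere_zero_iff_norm, ← sq_eq_sq₀ (norm_nonneg _) zero_le_one, one_pow,
    EuclideanSpace.real_norm_sq_eq, Fin.sum_univ_castSucc, Fin.sum_univ_castSucc,
    ← sum_sin_cos a d, ← Fin.sum_univ_eq_sum_range
      (fun i => ((∏ m ∈ Finset.range i, Real.sin (a m)) * Real.cos (a i)) ^ 2) d]
  have h1 : ∀ i : Fin d, sphericalVector ϑ φ i.castSucc.castSucc =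
      (∏ m ∈ Finset.range i, Real.sin (a m)) * Real.cos (a i) := by
    intro i
    have := hprod i i.2.le
    simp only [sphericalVector, Fin.val_castSucc, this]
    simp [ha]
  have h2 : sphericalVector ϑ φ (Fin.last d).castSucc =
      (∏ m ∈ Finset.range d, Real.sin (a m)) * Real.cos φ := by
    have := hprod d le_rfl
    simp only [sphericalVector, Fin.val_castSucc, Fin.val_last, this]
    simp
  have h3 : sphericalVector ϑ φ (Fin.last (d + 1)) =
      (∏ m ∈ Finset.range d, Real.sin (a m)) * Real.sin φ := by
    simp only [sphericalVector, Fin.val_last, hall]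
    simp
  rw [h2, h3, Finset.sum_congr rfl fun i _ => by rw [h1 i]]
  linear_combination
    (∏ m ∈ Finset.range d, Real.sin (a m)) ^ 2 * Real.sin_sq_add_cos_sq φ

/-- The point of the sphere with spherical coordinates `(ϑ_1, …, ϑ_{n-1}, φ)`. -/
def sphericalPoint {n : ℕ} (hn : 2 ≤ n) (ϑ : Fin (n - 1) → ℝ) (φ : ℝ) : Sphere n :=
  ⟨sphericalVector ϑ φ, sphericalVector_mem hn ϑ φ⟩

/-- The colatitude `ϑ_ν ∈ [0, π]` of `x`: `cos ϑ_ν = x_ν / |(x_ν, …, x_{n+1})|`. Where the vector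
`(x_ν, …, x_{n+1})` vanishes, `ϑ_ν` is undetermined and takes the value `π / 2`; the hyperspherical
harmonics do not depend on the choice. -/
def colatitude {n : ℕ} (x : Sphere n) (ν : Fin (n - 1)) : ℝ :=
  Real.arccos (x.1 ⟨ν, by omega⟩ / Real.sqrt (∑ i : Fin (n + 1) with ν.val ≤ i.val, x.1 i ^ 2))

/-- The azimuth `φ` of `x` (modulo `2 π`): the argument of `x_n + i x_{n+1}`. -/
def azimuth {n : ℕ} (hn : 2 ≤ n) (x : Sphere n) : ℝ :=
  Complex.arg ⟨x.1 ⟨n - 1, by omega⟩, x.1 ⟨n, by omega⟩⟩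

/-! ### The basis of hyperspherical harmonics

The sequence `k = (k_1, …, ± k_{n-1})` is stored with its sign: `k : Fin (n - 1) → ℤ`, where only
the last entry may be negative. -/

/-- The sequence `k_0 = l, k_1, …, k_{n-1}` of nonnegative integers, where the sign of the last
entry of `k` is dropped. -/
def orders {n : ℕ} (l : ℕ) (k : Fin (n - 1) → ℤ) : Fin (n - 1 + 1) → ℕ :=
  Fin.cons l fun ν => (k ν).natAbs

/-- The index set `I_j` of the hyperspherical harmonics that span `V_j`:
`l ≤ 2 ^ (j - 1) - 1` and `l ≥ k_1 ≥ … ≥ k_{n-1} ≥ 0`, with a sign at the last entry. -/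
def indexSet (n j : ℕ) : Set (ℕ × (Fin (n - 1) → ℤ)) :=
  {p | p.1 < 2 ^ (j - 1) ∧
    (∀ ν : Fin (n - 1), orders p.1 p.2 ν.succ ≤ orders p.1 p.2 ν.castSucc) ∧
    ∀ ν : Fin (n - 1), (ν : ℕ) + 1 < n - 1 → 0 ≤ p.2 ν}

/-- The product of Gegenbauer polynomials, powers of sines and the exponential that defines
`Y_l^k` up to its normalization constant. -/
def harmonicUnnormalized {n : ℕ} (hn : 2 ≤ n) (l : ℕ) (k : Fin (n - 1) → ℤ) (x : Sphere n) : ℂ :=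
  ((∏ ν : Fin (n - 1),
      gegenbauer (orders l k ν.castSucc - orders l k ν.succ)
          (((n : ℝ) - ((ν : ℕ) + 1)) / 2 + orders l k ν.succ) (Real.cos (colatitude x ν)) *
        Real.sin (colatitude x ν) ^ orders l k ν.succ : ℝ) : ℂ) *
    Complex.exp (Complex.I * (k ⟨n - 2, by omega⟩ : ℂ) * (azimuth hn x : ℂ))

/-- The scalar product of `L²`, with respect to the normalized surface measure. -/
def l2Inner {n : ℕ} (f g : Sphere n → ℂ) : ℂ :=
  (1 / sphereArea n : ℝ) * ∫ x, conj (f x) * g x ∂(surfaceMeasure n)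

/-- The normalization constant `A_l^k > 0`, for which `Y_l^k` has `L²`-norm one. -/
def normalization {n : ℕ} (hn : 2 ≤ n) (l : ℕ) (k : Fin (n - 1) → ℤ) : ℝ :=
  1 / Real.sqrt (l2Inner (harmonicUnnormalized hn l k) (harmonicUnnormalized hn l k)).re

/-- The hyperspherical harmonic `Y_l^k`. -/
def sphericalHarmonic {n : ℕ} (hn : 2 ≤ n) (l : ℕ) (k : Fin (n - 1) → ℤ) (x : Sphere n) : ℂ :=
  (normalization hn l k : ℂ) * harmonicUnnormalized hn l k x

/-- The Fourier coefficient `a_l^k(f) = ⟨Y_l^k, f⟩`. -/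
def fourierCoeff {n : ℕ} (hn : 2 ≤ n) (l : ℕ) (k : Fin (n - 1) → ℤ) (f : Sphere n → ℂ) : ℂ :=
  l2Inner (sphericalHarmonic hn l k) f

/-! ### The quadrature -/

/-- `ε_u`, equal to `1 / 2` for `u = 0` and `u = M`, and to `1` otherwise. -/
def epsilon (M u : ℕ) : ℝ := if u = 0 ∨ u = M then 1 / 2 else 1

/-- `ω_u` for the weight `sin ^ α`. Mathlib's `Γ` vanishes at the poles `0, -1, -2, …`, so that
the summands with a pole in the denominator are zero, as they should be. -/
def omegaWeight (M α u : ℕ) : ℝ :=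
  Real.pi * (α.factorial : ℝ) / (2 ^ (α - 1) * (M : ℝ)) *
    ∑ μ ∈ Finset.range (M / 2 + 1),
      epsilon M (2 * μ) * (-1) ^ μ * Real.cos (2 * (μ : ℝ) * (u : ℝ) * Real.pi / (M : ℝ)) /
        (Real.Gamma ((α : ℝ) / 2 - (μ : ℝ) + 1) * Real.Gamma ((α : ℝ) / 2 + (μ : ℝ) + 1))

/-- The generalized Clenshaw–Curtis weight `χ_u = ε_u ω_u`. -/
def chiWeight (M α u : ℕ) : ℝ := epsilon M u * omegaWeight M α u

/-- The index set `N_j` of the grid. -/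
abbrev GridIndex (n j : ℕ) : Type := (Fin (n - 1) → Fin (2 ^ j + 1)) × Fin (2 ^ (j + 1))

/-- The grid point `x_{s,t}^j` with spherical coordinates
`(s_1 π / 2 ^ j, …, s_{n-1} π / 2 ^ j, t π / 2 ^ j)`. -/
def gridPoint {n : ℕ} (hn : 2 ≤ n) (j : ℕ) (st : GridIndex n j) : Sphere n :=
  sphericalPoint hn (fun ν => ((st.1 ν : ℕ) : ℝ) * Real.pi / 2 ^ j)
    (((st.2 : ℕ) : ℝ) * Real.pi / 2 ^ j)

end SphereSampling

end

noncomputable section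

namespace SphereSampling

/-! ### Fourier coefficients of powers of the sine -/

/-! The integrand of the Fourier coefficient, the conjugate of `Y_l^k` times `f`, is on the sphere a
polynomial of degree at most `2 (2 ^ (j - 1) - 1) < 2 ^ j`. It therefore suffices that the grid rule
integrates every polynomial of degree at most `M = 2 ^ j` exactly (`grid_polynomial`), and by
linearity this is a statement about monomials (`grid_monomial`).

In spherical coordinates a monomial is a product of functions of one angle, so its grid sum factors
into one-dimensional sums. The factor of `ϑ_ν` is a power of the cosine times a power of the sine,
summed with the weights for `sin ^ (n - ν)`. These weights contain the exact Fourier coefficients of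
the weight function (`integral_cos_int_mul_sin_pow`), and discrete orthogonality of the cosines on
the nodes makes the rule exact for `cos (q θ)` with `q ≤ M` (`isExact_cos`).

If all exponents of the monomial are even, every factor is a polynomial in the cosine of degree at
most `M`. Its sum is then a Beta value, and the product of these values telescopes to the moment of
the surface measure. If some exponent is odd, the moment vanishes; a factor may carry an odd power
of the sine, for which exactness is not available, but another factor of the grid sum vanishes by
symmetry. The moments themselves come from integrating a monomial against a Gaussian in Cartesian
and in polar coordinates (`integral_sphere_monomial`).

That `Y_l^k` is a polynomial of degree at most `l` follows by distributing the radii `r_ν = |(x_ν,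
…, x_{n+1})|` over its factors: `sin ϑ_ν = r_{ν+1} / r_ν`, and each Gegenbauer factor becomes a
homogeneous polynomial (`harmonicUnnormalized_eq`). -/

theorem inv_Gamma_eq_mul (x : ℝ) : (Real.Gamma x)⁻¹ = x * (Real.Gamma (x + 1))⁻¹ := by
  rcases eq_or_ne x 0 with rfl | hx
  · simp
  · rw [Real.Gamma_add_one hx, mul_inv, ← mul_assoc, mul_inv_cancel₀ hx, one_mul]

/-- From `sin² θ = (1 - cos 2θ) / 2` and the product formula for cosines. Integer `m` keeps the
shift `m - 1` available at `m = 0`. -/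
theorem integral_cos_int_mul_sin_pow_add_two (α : ℕ) (m : ℤ) :
    ∫ θ in (0 : ℝ)..Real.pi, Real.cos (2 * m * θ) * Real.sin θ ^ (α + 2) =
      (∫ θ in (0 : ℝ)..Real.pi, Real.cos (2 * m * θ) * Real.sin θ ^ α) / 2 -
      ((∫ θ in (0 : ℝ)..Real.pi, Real.cos (2 * (m + 1 : ℤ) * θ) * Real.sin θ ^ α) +
        ∫ θ in (0 : ℝ)..Real.pi, Real.cos (2 * (m - 1 : ℤ) * θ) * Real.sin θ ^ α) / 4 := by
  have hc : ∀ k : ℤ, IntervalIntegrable (fun θ => Real.cos (2 * k * θ) * Real.sin θ ^ α)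
      MeasureTheory.volume 0 Real.pi := fun k => by
    apply Continuous.intervalIntegrable; fun_prop
  rw [← intervalIntegral.integral_add (hc _) (hc _), ← intervalIntegral.integral_div,
    ← intervalIntegral.integral_div, ← intervalIntegral.integral_sub ((hc _).div_const _)
      (((hc _).add (hc _)).div_const _)]
  refine intervalIntegral.integral_congr fun θ _ => ?_
  have h1 : Real.cos (2 * (m + 1 : ℤ) * θ) =
      Real.cos (2 * m * θ) * Real.cos (2 * θ) - Real.sin (2 * m * θ) * Real.sin (2 * θ) := by
    rw [← Real.cos_add]; push_cast; ring_nf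
  have h2 : Real.cos (2 * (m - 1 : ℤ) * θ) =
      Real.cos (2 * m * θ) * Real.cos (2 * θ) + Real.sin (2 * m * θ) * Real.sin (2 * θ) := by
    rw [← Real.cos_sub]; push_cast; ring_nf
  rw [h1, h2, Real.cos_two_mul, pow_add, Real.sin_sq]
  ring

theorem integral_cos_mul_of_ne_zero {c : ℝ} (hc : c ≠ 0) (a b : ℝ) :
    ∫ θ in a..b, Real.cos (c * θ) = (Real.sin (c * b) - Real.sin (c * a)) / c := by
  rw [intervalIntegral.integral_comp_mul_left (fun θ => Real.cos θ) hc, integral_cos, smul_eq_mul]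
  ring

theorem integral_sin_mul_of_ne_zero {c : ℝ} (hc : c ≠ 0) (a b : ℝ) :
    ∫ θ in a..b, Real.sin (c * θ) = (Real.cos (c * a) - Real.cos (c * b)) / c := by
  rw [intervalIntegral.integral_comp_mul_left (fun θ => Real.sin θ) hc, integral_sin, smul_eq_mul]
  ring

theorem integral_cos_int_mul_sin (m : ℤ) :
    ∫ θ in (0 : ℝ)..Real.pi, Real.cos (2 * m * θ) * Real.sin θ = 2 / (1 - 4 * (m : ℝ) ^ 2) := by
  have e1 : (2 * (m : ℝ) + 1) ≠ 0 := by exact_mod_cast (by omega : 2 * m + 1 ≠ 0)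
  have e2 : (1 - 2 * (m : ℝ)) ≠ 0 := by exact_mod_cast (by omega : 1 - 2 * m ≠ 0)
  have h : ∀ θ, Real.cos (2 * m * θ) * Real.sin θ =
      (Real.sin ((2 * m + 1) * θ) + Real.sin ((1 - 2 * m) * θ)) / 2 := by
    intro θ
    rw [show (2 * (m : ℝ) + 1) * θ = 2 * m * θ + θ by ring,
      show (1 - 2 * (m : ℝ)) * θ = θ - 2 * m * θ by ring, Real.sin_add, Real.sin_sub]
    ring
  have c1 : Real.cos ((2 * m + 1) * Real.pi) = -1 := by
    rw [show (2 * (m : ℝ) + 1) * Real.pi = Real.pi + m * (2 * Real.pi) by ring,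
      Real.cos_add_int_mul_two_pi, Real.cos_pi]
  have c2 : Real.cos ((1 - 2 * m) * Real.pi) = -1 := by
    rw [show (1 - 2 * (m : ℝ)) * Real.pi = Real.pi - m * (2 * Real.pi) by ring,
      Real.cos_sub_int_mul_two_pi, Real.cos_pi]
  simp_rw [h]
  rw [intervalIntegral.integral_div, intervalIntegral.integral_add
    (Continuous.intervalIntegrable (by fun_prop) _ _)
    (Continuous.intervalIntegrable (by fun_prop) _ _),
    integral_sin_mul_of_ne_zero e1, integral_sin_mul_of_ne_zero e2, c1, c2]
  simp only [mul_zero, Real.cos_zero]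
  rw [show 1 - 4 * (m : ℝ) ^ 2 = (2 * (m : ℝ) + 1) * (1 - 2 * (m : ℝ)) by ring]
  field_simp
  ring

/-- The case `α = 1` of the closed form below. Passing from `m` to `m + 1` shifts one Gamma argument
down and the other up, so only `Γ (3 / 2) = √π / 2` has to be evaluated. -/
theorem inv_Gamma_mul_inv_Gamma_three_half (m : ℕ) :
    (-1) ^ m * Real.pi / 2 *
      ((Real.Gamma ((1 : ℝ) / 2 - m + 1))⁻¹ * (Real.Gamma ((1 : ℝ) / 2 + m + 1))⁻¹) =
      2 / (1 - 4 * (m : ℝ) ^ 2) := by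
  induction m with
  | zero =>
    have h : Real.Gamma ((1 : ℝ) / 2 + 1) = Real.sqrt Real.pi / 2 := by
      rw [Real.Gamma_add_one (by norm_num), Real.Gamma_one_half_eq]; ring
    have hs := Real.sq_sqrt Real.pi_pos.le
    have hp : Real.sqrt Real.pi ≠ 0 := (Real.sqrt_pos.2 Real.pi_pos).ne'
    simp only [Nat.cast_zero, sub_zero, add_zero, h]
    field_simp
    rw [hs]; norm_num
  | succ m ih =>
    have h1 := inv_Gamma_eq_mul ((1 : ℝ) / 2 - (m + 1 : ℕ) + 1)
    have h2 := inv_Gamma_eq_mul ((1 : ℝ) / 2 + m + 1)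
    rw [show (1 : ℝ) / 2 - (m + 1 : ℕ) + 1 + 1 = 1 / 2 - m + 1 by push_cast; ring] at h1
    rw [show (1 : ℝ) / 2 + m + 1 + 1 = 1 / 2 + (m + 1 : ℕ) + 1 by push_cast; ring] at h2
    rw [h2] at ih
    rw [h1]
    have e1 : (2 * (m : ℝ) + 1) ≠ 0 := by positivity
    have e2 : (1 - 2 * (m : ℝ)) ≠ 0 := by exact_mod_cast (by omega : 1 - 2 * (m : ℤ) ≠ 0)
    have e4 : (2 * (m : ℝ) + 3) ≠ 0 := by positivity
    have e3 : 1 - 4 * (m : ℝ) ^ 2 = (2 * (m : ℝ) + 1) * (1 - 2 * (m : ℝ)) := by ring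
    have e5 : 1 - 4 * ((m + 1 : ℕ) : ℝ) ^ 2 = - (2 * (m : ℝ) + 1) * (2 * m + 3) := by
      push_cast; ring
    rw [e3] at ih
    rw [e5]
    generalize (Real.Gamma ((1 : ℝ) / 2 - m + 1))⁻¹ = A at *
    generalize (Real.Gamma ((1 : ℝ) / 2 + (m + 1 : ℕ) + 1))⁻¹ = B at *
    push_cast
    have key : (-1) ^ m * Real.pi / 2 * (A * B) =
        2 / ((2 * (m : ℝ) + 1) * (1 - 2 * (m : ℝ))) / ((1 : ℝ) / 2 + m + 1) := by
      rw [← ih]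
      have : (1 : ℝ) / 2 + m + 1 ≠ 0 := by positivity
      field_simp
    calc _ = - ((1 : ℝ) / 2 - (m + 1) + 1) * ((-1) ^ m * Real.pi / 2 * (A * B)) := by ring
      _ = _ := by
        rw [key]
        have : (1 : ℝ) / 2 + m + 1 = (2 * m + 3) / 2 := by ring
        rw [this]
        field_simp
        ring

/-- Induction on `α` in steps of two. Once all reciprocal Gammas are expressed through `1 / Γ (c - m
+ 2)` and `1 / Γ (c + m + 2)` with `c = α / 2`, the recurrence is a polynomial identity. The shift
of `1 / Γ` holds at the poles too, where both sides are zero. -/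
theorem integral_cos_int_mul_sin_pow (α : ℕ) : ∀ m : ℤ,
    ∫ θ in (0 : ℝ)..Real.pi, Real.cos (2 * m * θ) * Real.sin θ ^ α =
      (-1) ^ m.natAbs * Real.pi * (α.factorial : ℝ) / 2 ^ α *
        ((Real.Gamma ((α : ℝ) / 2 - m + 1))⁻¹ * (Real.Gamma ((α : ℝ) / 2 + m + 1))⁻¹) := by
  have hsign : ∀ m : ℤ, ((-1 : ℝ)) ^ (m + 1).natAbs = -(-1) ^ m.natAbs := by
    intro m
    rcases Int.even_or_odd m with h | h
    · have h' : Odd (m + 1) := h.add_one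
      rw [(Int.natAbs_even.2 h).neg_one_pow, (Int.natAbs_odd.2 h').neg_one_pow]
    · have h' : Even (m + 1) := h.add_one
      rw [(Int.natAbs_odd.2 h).neg_one_pow, (Int.natAbs_even.2 h').neg_one_pow]; simp
  induction α using Nat.twoStepInduction with
  | zero =>
    intro m
    rcases eq_or_ne m 0 with rfl | hm
    · simp
    · have hm' : (2 * m : ℝ) ≠ 0 := by simpa using hm
      have hs : Real.sin (2 * m * Real.pi) = 0 := by
        have := Real.sin_int_mul_pi (2 * m); push_cast at this; exact this
      simp only [pow_zero, mul_one]
      rw [integral_cos_mul_of_ne_zero hm', hs]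
      -- One of the two arguments is `1 - |m|`, a pole of `Γ`, where the value is `0` by convention.
      have : (Real.Gamma (((0 : ℕ) : ℝ) / 2 - m + 1))⁻¹ *
          (Real.Gamma (((0 : ℕ) : ℝ) / 2 + m + 1))⁻¹ = 0 := by
        rcases lt_or_gt_of_ne hm with h | h
        · have : Real.Gamma (((0 : ℕ) : ℝ) / 2 + m + 1) = 0 := by
            rw [Real.Gamma_eq_zero_iff]
            refine ⟨(-m - 1).toNat, ?_⟩
            have : (((-m - 1).toNat : ℤ) : ℝ) = ((-m - 1 : ℤ) : ℝ) := by
              rw [Int.toNat_of_nonneg (by omega)]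
            rw [Int.cast_natCast] at this
            rw [this]; push_cast; ring
          rw [this]; simp
        · have : Real.Gamma (((0 : ℕ) : ℝ) / 2 - m + 1) = 0 := by
            rw [Real.Gamma_eq_zero_iff]
            refine ⟨(m - 1).toNat, ?_⟩
            have : (((m - 1).toNat : ℤ) : ℝ) = ((m - 1 : ℤ) : ℝ) := by
              rw [Int.toNat_of_nonneg (by omega)]
            rw [Int.cast_natCast] at this
            rw [this]; push_cast; ring
          rw [this]; simp
      rw [this]; simp
  | one =>
    intro m
    simp only [pow_one]
    rw [integral_cos_int_mul_sin]
    rcases Int.natAbs_eq m with h | h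
    · have := inv_Gamma_mul_inv_Gamma_three_half m.natAbs
      have hc : (m : ℝ) = (m.natAbs : ℝ) := by rw [← Int.cast_natCast, ← h]
      rw [hc, ← this]; simp
    · have := inv_Gamma_mul_inv_Gamma_three_half m.natAbs
      have hc : (m : ℝ) = -(m.natAbs : ℝ) := by
        rw [← Int.cast_natCast, ← Int.cast_neg, ← h]
      rw [hc, neg_sq, ← this, sub_neg_eq_add, ← sub_eq_add_neg]; simp; ring
  | more α ih _ =>
    intro m
    rw [integral_cos_int_mul_sin_pow_add_two, ih, ih, ih, hsign]
    have hs' : ((-1 : ℝ)) ^ (m - 1).natAbs = -(-1) ^ m.natAbs := by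
      have := hsign (m - 1); rw [sub_add_cancel] at this; linarith
    rw [hs']
    set c : ℝ := (α : ℝ) / 2 with hcdef
    have hα : (α : ℝ) = 2 * c := by rw [hcdef]; ring
    have e1 : (((α + 2 : ℕ) : ℝ) / 2 - m + 1) = c - m + 1 + 1 := by push_cast; rw [hα]; ring
    have e2 : (((α + 2 : ℕ) : ℝ) / 2 + m + 1) = c + m + 1 + 1 := by push_cast; rw [hα]; ring
    have e3 : c - ((m + 1 : ℤ) : ℝ) + 1 = c - m := by push_cast; ring
    have e4 : c + ((m + 1 : ℤ) : ℝ) + 1 = c + m + 1 + 1 := by push_cast; ring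
    have e5 : c - ((m - 1 : ℤ) : ℝ) + 1 = c - m + 1 + 1 := by push_cast; ring
    have e6 : c + ((m - 1 : ℤ) : ℝ) + 1 = c + m := by push_cast; ring
    rw [e1, e2, e3, e4, e5, e6, inv_Gamma_eq_mul (c - m), inv_Gamma_eq_mul (c + m),
      inv_Gamma_eq_mul (c - m + 1), inv_Gamma_eq_mul (c + m + 1), Nat.factorial_succ,
      Nat.factorial_succ]
    push_cast
    rw [hα]
    ring

/-! ### Moments on `[0, π]` -/

theorem integral_sin_pow_eq_Gamma (b : ℕ) :
    ∫ θ in (0 : ℝ)..Real.pi, Real.sin θ ^ b =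
      Real.Gamma (1 / 2) * Real.Gamma (((b : ℝ) + 1) / 2) / Real.Gamma (((b : ℝ) + 2) / 2) := by
  induction b using Nat.twoStepInduction with
  | zero =>
    have hs := Real.mul_self_sqrt Real.pi_pos.le
    have hg := Real.Gamma_one_half_eq
    rw [one_div] at hg
    simp [hg, hs]
  | one =>
    have h : Real.Gamma (((1 : ℕ) + 2 : ℝ) / 2) = Real.Gamma (1 / 2) / 2 := by
      rw [show ((1 : ℕ) + 2 : ℝ) / 2 = 1 / 2 + 1 by norm_num, Real.Gamma_add_one (by norm_num)]
      ring
    rw [h]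
    have h0 : Real.Gamma (1 / 2) ≠ 0 := (Real.Gamma_pos_of_pos (by norm_num)).ne'
    simp only [pow_one, integral_sin, Real.cos_zero, Real.cos_pi]
    rw [show ((1 : ℕ) + 1 : ℝ) / 2 = 1 by norm_num, Real.Gamma_one]
    field_simp
    norm_num
  | more b ih _ =>
    rw [integral_sin_pow, ih, show (((b + 2 : ℕ) : ℝ) + 1) / 2 = ((b : ℝ) + 1) / 2 + 1 by
      push_cast; ring, show (((b + 2 : ℕ) : ℝ) + 2) / 2 = ((b : ℝ) + 2) / 2 + 1 by
      push_cast; ring, Real.Gamma_add_one (by positivity), Real.Gamma_add_one (by positivity)]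
    have h0 : Real.Gamma (((b : ℝ) + 2) / 2) ≠ 0 := (Real.Gamma_pos_of_pos (by positivity)).ne'
    simp
    field_simp

/-- Replacing `cos²` by `1 - sin²` lowers `a` by two but also produces `b + 2`, so the induction
runs over all `b` at once. -/
theorem integral_cos_pow_mul_sin_pow_of_even {a : ℕ} (ha : Even a) : ∀ b : ℕ,
    ∫ θ in (0 : ℝ)..Real.pi, Real.cos θ ^ a * Real.sin θ ^ b =
      Real.Gamma (((a : ℝ) + 1) / 2) * Real.Gamma (((b : ℝ) + 1) / 2) /
        Real.Gamma (((a : ℝ) + b + 2) / 2) := by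
  obtain ⟨a, rfl⟩ := ha
  induction a with
  | zero => intro b; simpa using integral_sin_pow_eq_Gamma b
  | succ a ih =>
    intro b
    have h : ∀ θ, Real.cos θ ^ (a + 1 + (a + 1)) * Real.sin θ ^ b =
        Real.cos θ ^ (a + a) * Real.sin θ ^ b - Real.cos θ ^ (a + a) * Real.sin θ ^ (b + 2) := by
      intro θ
      rw [pow_add (Real.sin θ) b 2, Real.sin_sq]; ring
    simp_rw [h]
    rw [intervalIntegral.integral_sub (Continuous.intervalIntegrable (by fun_prop) _ _)
      (Continuous.intervalIntegrable (by fun_prop) _ _), ih, ih]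
    have h0 : Real.Gamma (((a + a : ℕ) + b + 2 : ℝ) / 2) ≠ 0 :=
      (Real.Gamma_pos_of_pos (by positivity)).ne'
    rw [show (((b + 2 : ℕ) : ℝ) + 1) / 2 = ((b : ℝ) + 1) / 2 + 1 by push_cast; ring,
      show (((a + a : ℕ) : ℝ) + (b + 2 : ℕ) + 2) / 2 = (((a + a : ℕ) : ℝ) + b + 2) / 2 + 1 by
        push_cast; ring,
      show (((a + 1 + (a + 1) : ℕ) : ℝ) + b + 2) / 2 = (((a + a : ℕ) : ℝ) + b + 2) / 2 + 1 by
        push_cast; ring,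
      show (((a + 1 + (a + 1) : ℕ) : ℝ) + 1) / 2 = (((a + a : ℕ) : ℝ) + 1) / 2 + 1 by
        push_cast; ring,
      Real.Gamma_add_one (s := ((b : ℝ) + 1) / 2) (by positivity),
      Real.Gamma_add_one (s := (((a + a : ℕ) : ℝ) + b + 2) / 2) (by positivity),
      Real.Gamma_add_one (s := (((a + a : ℕ) : ℝ) + 1) / 2) (by positivity)]
    have h1 : (((a + a : ℕ) : ℝ) + b + 2) ≠ 0 := by positivity
    field_simp
    ring

/-! ### The trapezoidal rule and discrete orthogonality of the cosines -/

/-- The halved end nodes are what averaging over adjacent nodes leaves; in this form the cosine sums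
telescope. -/
theorem sum_epsilon_mul {M : ℕ} (hM : 0 < M) (g : ℕ → ℝ) :
    ∑ u ∈ Finset.range (M + 1), epsilon M u * g u =
      ∑ u ∈ Finset.range M, (g u + g (u + 1)) / 2 := by
  have h1 : ∑ u ∈ Finset.range (M + 1), epsilon M u * g u =
      g 0 / 2 + g M / 2 + ∑ u ∈ Finset.range (M - 1), g (u + 1) := by
    obtain ⟨N, rfl⟩ : ∃ N, M = N + 1 := ⟨M - 1, by omega⟩
    rw [Finset.sum_range_succ, Finset.sum_range_succ']
    have : ∀ u ∈ Finset.range N, epsilon (N + 1) (u + 1) * g (u + 1) = g (u + 1) := by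
      intro u hu
      have := Finset.mem_range.1 hu
      rw [epsilon, if_neg (by omega), one_mul]
    rw [Finset.sum_congr rfl this]
    simp [epsilon]
    ring
  rw [h1, ← Finset.sum_div, Finset.sum_add_distrib]
  obtain ⟨N, rfl⟩ : ∃ N, M = N + 1 := ⟨M - 1, by omega⟩
  rw [Finset.sum_range_succ' (fun u => g u), Finset.sum_range_succ (fun u => g (u + 1))]
  simp
  ring

theorem epsilon_symm {M u : ℕ} (hu : u ≤ M) : epsilon M (M - u) = epsilon M u := by
  unfold epsilon
  by_cases h : u = 0 ∨ u = M
  · rw [if_pos h, if_pos (by omega)]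
  · rw [if_neg h, if_neg (by omega)]

/-- A cosine of integer frequency `r` sums to zero under the trapezoidal rule unless `2 M ∣ r`. -/
theorem sum_epsilon_mul_cos {M : ℕ} (hM : 0 < M) {r : ℤ} (hr : ¬ (2 * (M : ℤ)) ∣ r) :
    ∑ u ∈ Finset.range (M + 1), epsilon M u * Real.cos (r * (u * Real.pi / M)) = 0 := by
  have hM0 : (M : ℝ) ≠ 0 := by positivity
  -- Half the phase increment between nodes: `sin x` vanishes exactly when `2 M ∣ r`, and
  -- multiplying the sum by `sin x` makes it telescope.
  set x : ℝ := r * Real.pi / (2 * M) with hx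
  have hsin : Real.sin x ≠ 0 := by
    intro h
    obtain ⟨k, hk⟩ := Real.sin_eq_zero_iff.1 h
    apply hr
    refine ⟨k, ?_⟩
    have : (r : ℝ) = 2 * M * k := by
      have hp := Real.pi_ne_zero
      rw [hx] at hk
      field_simp at hk
      linarith
    exact_mod_cast this
  have hsum : ∀ K : ℕ, ∑ u ∈ Finset.range K,
      (Real.cos (r * (u * Real.pi / M)) + Real.cos (r * ((u + 1 : ℕ) * Real.pi / M))) / 2 *
        Real.sin x = Real.cos x * Real.sin (2 * K * x) / 2 := by
    intro K
    induction K with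
    | zero => simp
    | succ K ih =>
      rw [Finset.sum_range_succ, ih]
      have e1 : r * (K * Real.pi / M) = 2 * K * x := by rw [hx]; field_simp
      have e2 : r * ((K + 1 : ℕ) * Real.pi / M) = 2 * K * x + 2 * x := by
        rw [hx]; push_cast; field_simp
      have e3 : 2 * ((K + 1 : ℕ) : ℝ) * x = 2 * K * x + 2 * x := by push_cast; ring
      rw [e1, e2, e3, Real.cos_add, Real.sin_add, Real.sin_two_mul, Real.cos_two_mul]
      linear_combination (2⁻¹ * Real.sin (2 * K * x) * Real.cos x * 2) *
        (Real.sin_sq_add_cos_sq x) * (-1)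
  have hpi : Real.sin (2 * M * x) = 0 := by
    rw [show 2 * M * x = r * Real.pi by rw [hx]; field_simp, Real.sin_int_mul_pi]
  rw [sum_epsilon_mul hM (fun u => Real.cos (r * (u * Real.pi / M)))]
  have := hsum M
  rw [← Finset.sum_mul, hpi, mul_zero, zero_div] at this
  exact (mul_eq_zero.1 this).resolve_right hsin

theorem sum_epsilon {M : ℕ} (hM : 0 < M) : ∑ u ∈ Finset.range (M + 1), epsilon M u = M := by
  simpa using sum_epsilon_mul hM (fun _ => 1)

theorem sum_epsilon_mul_cos_of_dvd {M : ℕ} (hM : 0 < M) {r : ℤ} (hr : (2 * (M : ℤ)) ∣ r) :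
    ∑ u ∈ Finset.range (M + 1), epsilon M u * Real.cos (r * (u * Real.pi / M)) = M := by
  refine Eq.trans ?_ (sum_epsilon hM)
  refine Finset.sum_congr rfl fun u _ => ?_
  obtain ⟨k, rfl⟩ := hr
  have hM0 : (M : ℝ) ≠ 0 := by positivity
  rw [show ((2 * (M : ℤ) * k : ℤ) : ℝ) * (u * Real.pi / M) = 0 + ((k * u : ℤ) : ℝ) * (2 * Real.pi)
    by push_cast; field_simp; ring, Real.cos_add_int_mul_two_pi, Real.cos_zero, mul_one]

/-- The product splits into the frequencies `p + q` and `p - q`. As `p, q ≤ M`, the difference is a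
multiple of `2 M` only for `p = q`, and the sum only for `p = q = 0` or `p = q = M`; the latter
doubling is the factor `1 / ε_q`. -/
theorem sum_epsilon_mul_cos_mul_cos {M p q : ℕ} (hM : 0 < M) (hp : p ≤ M) (hq : q ≤ M) :
    ∑ u ∈ Finset.range (M + 1), epsilon M u *
      (Real.cos (p * (u * Real.pi / M)) * Real.cos (q * (u * Real.pi / M))) =
      if p = q then (M : ℝ) / 2 / epsilon M q else 0 := by
  have h : ∀ u : ℕ, epsilon M u *
      (Real.cos (p * (u * Real.pi / M)) * Real.cos (q * (u * Real.pi / M))) =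
      (epsilon M u * Real.cos (((p + q : ℕ) : ℤ) * (u * Real.pi / M)) +
        epsilon M u * Real.cos (((p : ℤ) - q : ℤ) * (u * Real.pi / M))) / 2 := by
    intro u
    push_cast
    rw [add_mul, sub_mul, Real.cos_add, Real.cos_sub]
    ring
  simp_rw [h]
  rw [← Finset.sum_div, Finset.sum_add_distrib]
  have hd : ∀ r : ℤ, r ≠ 0 → |r| < 2 * M → ¬ (2 * (M : ℤ)) ∣ r := by
    intro r h0 h1 h2
    exact h0 (Int.eq_zero_of_abs_lt_dvd h2 h1)
  by_cases hpq : p = q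
  · subst hpq
    rw [if_pos rfl, sub_self, sum_epsilon_mul_cos_of_dvd hM (dvd_zero _)]
    by_cases h0 : p = 0 ∨ p = M
    · rw [sum_epsilon_mul_cos_of_dvd hM, epsilon, if_pos h0]
      · ring
      · rcases h0 with rfl | rfl
        · simp
        · refine ⟨1, ?_⟩; push_cast; ring
    · rw [sum_epsilon_mul_cos hM, epsilon, if_neg h0]
      · ring
      · apply hd
        · omega
        · rw [abs_of_nonneg (by omega)]; omega
  · rw [if_neg hpq, sum_epsilon_mul_cos hM, sum_epsilon_mul_cos hM]
    · simp
    · apply hd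
      · omega
      · rw [abs_lt]; omega
    · apply hd
      · omega
      · rw [abs_of_nonneg (by omega)]; omega

/-! ### The generalized Clenshaw–Curtis rule -/

/-- The interpolatory weights on the nodes `u π / M` for the weight function `sin ^ α`. -/
def clenshawWeight (M α u : ℕ) : ℝ :=
  epsilon M u * (2 / M * ∑ μ ∈ Finset.range (M / 2 + 1), epsilon M (2 * μ) *
    Real.cos ((2 * μ : ℕ) * (u * Real.pi / M)) *
      ∫ θ in (0 : ℝ)..Real.pi, Real.cos (2 * μ * θ) * Real.sin θ ^ α)

theorem chiWeight_eq_clenshawWeight {M α : ℕ} (hα : 1 ≤ α) (u : ℕ) :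
    chiWeight M α u = clenshawWeight M α u := by
  rw [chiWeight, clenshawWeight, omegaWeight]
  simp only [Finset.mul_sum]
  refine Finset.sum_congr rfl fun μ _ => ?_
  have h := integral_cos_int_mul_sin_pow α μ
  rw [Int.cast_natCast] at h
  rw [h, Int.natAbs_natCast]
  obtain ⟨β, rfl⟩ : ∃ β, α = β + 1 := ⟨α - 1, by omega⟩
  rw [Nat.add_sub_cancel, show 2 * (μ : ℝ) * u * Real.pi / M = (2 * μ : ℕ) * (u * Real.pi / M) by
    push_cast; ring]
  simp only [div_eq_mul_inv, mul_inv, pow_succ]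
  ring

/-- Without a sine weight only `μ = 0` survives and the rule is the trapezoidal rule. This brings
the azimuth under the same exactness results as the colatitudes. -/
theorem clenshawWeight_zero (M u : ℕ) :
    clenshawWeight M 0 u = epsilon M u * (Real.pi / M) := by
  rw [clenshawWeight, Finset.sum_eq_single (0 : ℕ)]
  · have : epsilon M (2 * 0) = 1 / 2 := by simp [epsilon]
    rw [this]
    simp
    ring_nf
    simp
  · intro μ _ hμ
    have h := integral_cos_mul_of_ne_zero (c := 2 * (μ : ℝ)) (by simpa using hμ) 0 Real.pi
    have hs : Real.sin (2 * μ * Real.pi) = 0 := by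
      have := Real.sin_nat_mul_pi (2 * μ); push_cast at this; exact this
    simp [h, hs]
  · simp

/-- The rule with the weights `clenshawWeight M α` is exact for `g`. -/
def IsExact (M α : ℕ) (g : ℝ → ℝ) : Prop :=
  Continuous g ∧ ∑ u ∈ Finset.range (M + 1), clenshawWeight M α u * g (u * Real.pi / M) =
    ∫ θ in (0 : ℝ)..Real.pi, g θ * Real.sin θ ^ α

theorem IsExact.add {M α : ℕ} {g h : ℝ → ℝ} (hg : IsExact M α g) (hh : IsExact M α h) :
    IsExact M α (fun θ => g θ + h θ) := by
  have h1 := hg.1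
  have h2 := hh.1
  refine ⟨h1.add h2, ?_⟩
  simp_rw [mul_add, add_mul]
  rw [Finset.sum_add_distrib, hg.2, hh.2, intervalIntegral.integral_add
    (Continuous.intervalIntegrable (by fun_prop) _ _)
    (Continuous.intervalIntegrable (by fun_prop) _ _)]

theorem IsExact.const_mul {M α : ℕ} {g : ℝ → ℝ} (hg : IsExact M α g) (c : ℝ) :
    IsExact M α (fun θ => c * g θ) := by
  refine ⟨continuous_const.mul hg.1, ?_⟩
  simp_rw [mul_left_comm _ c, mul_assoc c]
  rw [← Finset.mul_sum, hg.2, intervalIntegral.integral_const_mul]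

theorem clenshawWeight_symm {M : ℕ} (hM : 0 < M) (α : ℕ) {u : ℕ} (hu : u ≤ M) :
    clenshawWeight M α (M - u) = clenshawWeight M α u := by
  rw [clenshawWeight, clenshawWeight, epsilon_symm hu]
  congr 2
  refine Finset.sum_congr rfl fun μ _ => ?_
  have hM0 : (M : ℝ) ≠ 0 := by positivity
  have : ((2 * μ : ℕ) : ℝ) * ((M - u : ℕ) * Real.pi / M) =
      (μ : ℕ) * (2 * Real.pi) - (2 * μ : ℕ) * (u * Real.pi / M) := by
    rw [Nat.cast_sub hu]; push_cast; field_simp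
  rw [this, Real.cos_nat_mul_two_pi_sub]

theorem sum_clenshawWeight_of_antisymm {M : ℕ} (hM : 0 < M) (α : ℕ) {g : ℝ → ℝ}
    (hg : ∀ θ, g (Real.pi - θ) = - g θ) :
    ∑ u ∈ Finset.range (M + 1), clenshawWeight M α u * g (u * Real.pi / M) = 0 := by
  have h := Finset.sum_range_reflect
    (fun u : ℕ => clenshawWeight M α u * g (u * Real.pi / M)) (M + 1)
  have h2 : ∀ u ∈ Finset.range (M + 1),
      clenshawWeight M α (M + 1 - 1 - u) * g ((M + 1 - 1 - u : ℕ) * Real.pi / M) =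
        - (clenshawWeight M α u * g (u * Real.pi / M)) := by
    intro u hu
    have hu' : u ≤ M := by have := Finset.mem_range.1 hu; omega
    have hM0 : (M : ℝ) ≠ 0 := by positivity
    rw [Nat.add_sub_cancel, clenshawWeight_symm hM α hu', Nat.cast_sub hu',
      show ((M : ℝ) - u) * Real.pi / M = Real.pi - u * Real.pi / M by field_simp, hg]
    ring
  rw [Finset.sum_congr rfl h2, Finset.sum_neg_distrib] at h
  linarith

/-- For even `q`, orthogonality on the nodes extracts the summand `2 μ = q` of the weights, which
carries the required integral. For odd `q` both sides vanish: the weights and `sin ^ α` are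
symmetric about `π / 2`, and `cos (q θ)` is antisymmetric. -/
theorem isExact_cos {N α q : ℕ} (hN : 0 < N) (hq : q ≤ 2 * N) :
    IsExact (2 * N) α (fun θ => Real.cos (q * θ)) := by
  refine ⟨by fun_prop, ?_⟩
  have hM : 0 < 2 * N := by omega
  rcases Nat.even_or_odd' q with ⟨m, rfl | rfl⟩
  · have hsw : ∑ u ∈ Finset.range (2 * N + 1), clenshawWeight (2 * N) α u *
        Real.cos ((2 * m : ℕ) * (u * Real.pi / (2 * N : ℕ))) =
        2 / (2 * N : ℕ) * ∑ μ ∈ Finset.range (2 * N / 2 + 1),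
          (epsilon (2 * N) (2 * μ) *
            ∫ θ in (0 : ℝ)..Real.pi, Real.cos (2 * μ * θ) * Real.sin θ ^ α) *
          ∑ u ∈ Finset.range (2 * N + 1), epsilon (2 * N) u *
            (Real.cos ((2 * μ : ℕ) * (u * Real.pi / (2 * N : ℕ))) *
              Real.cos ((2 * m : ℕ) * (u * Real.pi / (2 * N : ℕ)))) := by
      simp_rw [clenshawWeight, Finset.mul_sum, Finset.sum_mul]
      rw [Finset.sum_comm]
      refine Finset.sum_congr rfl fun μ _ => Finset.sum_congr rfl fun u _ => ?_
      ring
    rw [hsw, Finset.sum_eq_single m]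
    -- The factor `ε_q` in the weight cancels the `1 / ε_q` of the discrete norm, so the top
    -- frequency `q = M` is included.
    · rw [sum_epsilon_mul_cos_mul_cos hM hq hq, if_pos rfl]
      have h1 : ((2 * N : ℕ) : ℝ) ≠ 0 := by positivity
      have h2 : epsilon (2 * N) (2 * m) ≠ 0 := by unfold epsilon; split_ifs <;> norm_num
      push_cast at h1 ⊢
      field_simp
    · intro μ hμ hne
      have := Finset.mem_range.1 hμ
      rw [sum_epsilon_mul_cos_mul_cos hM (by omega) hq, if_neg (by omega), mul_zero]
    · intro h
      exact absurd (Finset.mem_range.2 (by omega)) h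
  · have hanti : ∀ θ, Real.cos ((2 * m + 1 : ℕ) * (Real.pi - θ)) =
        - Real.cos ((2 * m + 1 : ℕ) * θ) := by
      intro θ
      rw [show ((2 * m + 1 : ℕ) : ℝ) * (Real.pi - θ) =
        Real.pi - (2 * m + 1 : ℕ) * θ + m * (2 * Real.pi) by push_cast; ring,
        Real.cos_add_nat_mul_two_pi, Real.cos_pi_sub]
    rw [sum_clenshawWeight_of_antisymm (g := fun θ => Real.cos ((2 * m + 1 : ℕ) * θ)) hM α hanti]
    have h := intervalIntegral.integral_comp_sub_left (a := 0) (b := Real.pi)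
      (fun θ => Real.cos ((2 * m + 1 : ℕ) * θ) * Real.sin θ ^ α) Real.pi
    simp only [hanti, Real.sin_pi_sub, sub_self, sub_zero, neg_mul,
      intervalIntegral.integral_neg] at h
    linarith

/-- Each factor `cos θ` moves the frequency `q` to `q ± 1`, so the bound on `a + q` is preserved. -/
theorem isExact_cos_pow_mul_cos {N α : ℕ} (hN : 0 < N) (a : ℕ) : ∀ q, a + q ≤ 2 * N →
    IsExact (2 * N) α (fun θ => Real.cos θ ^ a * Real.cos (q * θ)) := by
  induction a with
  | zero => intro q hq; simpa using isExact_cos hN (by omega)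
  | succ a ih =>
    intro q hq
    rcases q with _ | q
    · have := ih 1 (by omega)
      simpa [pow_succ] using this
    · have h := ((ih (q + 2) (by omega)).add (ih q (by omega))).const_mul (1 / 2)
      convert h using 2 with θ
      rw [show ((q + 2 : ℕ) : ℝ) * θ = (q + 1 : ℕ) * θ + θ by push_cast; ring,
        show (q : ℝ) * θ = (q + 1 : ℕ) * θ - θ by push_cast; ring, Real.cos_add, Real.cos_sub]
      ring

theorem isExact_cos_pow_mul_sin_pow {N α : ℕ} (hN : 0 < N) {b : ℕ} (hb : Even b) :
    ∀ a, a + b ≤ 2 * N → IsExact (2 * N) α (fun θ => Real.cos θ ^ a * Real.sin θ ^ b) := by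
  obtain ⟨b, rfl⟩ := hb
  induction b with
  | zero => intro a ha; simpa using isExact_cos_pow_mul_cos hN a 0 (by omega)
  | succ b ih =>
    intro a ha
    have h := (ih a (by omega)).add ((ih (a + 2) (by omega)).const_mul (-1))
    convert h using 2 with θ
    rw [show b + 1 + (b + 1) = b + b + 2 by ring, pow_add _ _ 2, Real.sin_sq]
    ring

theorem sum_clenshawWeight_cos_pow_mul_sin_pow_of_even {N α a b : ℕ} (hN : 0 < N) (ha : Even a)
    (hb : Even b) (hab : a + b ≤ 2 * N) :
    ∑ u ∈ Finset.range (2 * N + 1), clenshawWeight (2 * N) α u *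
      (Real.cos (u * Real.pi / (2 * N : ℕ)) ^ a * Real.sin (u * Real.pi / (2 * N : ℕ)) ^ b) =
      Real.Gamma (((a : ℝ) + 1) / 2) * Real.Gamma (((b : ℝ) + α + 1) / 2) /
        Real.Gamma (((a : ℝ) + b + α + 2) / 2) := by
  rw [(isExact_cos_pow_mul_sin_pow hN hb a hab).2]
  simp_rw [mul_assoc, ← pow_add]
  rw [integral_cos_pow_mul_sin_pow_of_even ha]
  push_cast
  ring_nf

/-- Pure symmetry under `θ ↦ π - θ`, hence no condition on the degree or on the parity of `b`. -/
theorem sum_clenshawWeight_cos_pow_mul_sin_pow_of_odd {M a : ℕ} (hM : 0 < M) (ha : Odd a)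
    (α b : ℕ) :
    ∑ u ∈ Finset.range (M + 1), clenshawWeight M α u *
      (Real.cos (u * Real.pi / M) ^ a * Real.sin (u * Real.pi / M) ^ b) = 0 :=
  sum_clenshawWeight_of_antisymm hM α (g := fun θ => Real.cos θ ^ a * Real.sin θ ^ b) fun θ => by
    rw [Real.cos_pi_sub, Real.sin_pi_sub, ha.neg_pow, neg_mul]

/-! ### The equidistant rule on the circle -/

theorem sum_range_two_mul_of_antiperiodic {M : ℕ} {g : ℕ → ℝ} (hg : ∀ t, g (t + M) = - g t) :
    ∑ t ∈ Finset.range (2 * M), g t = 0 := by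
  rw [two_mul, Finset.sum_range_add, ← Finset.sum_add_distrib]
  refine Finset.sum_eq_zero fun t _ => ?_
  rw [add_comm M t, hg]; ring

theorem sum_range_two_mul_of_periodic {M : ℕ} (hM : 0 < M) {g : ℕ → ℝ}
    (hg : ∀ t, g (t + M) = g t) :
    ∑ t ∈ Finset.range (2 * M), g t = 2 * ∑ u ∈ Finset.range (M + 1), epsilon M u * g u := by
  have h0 : g M = g 0 := by simpa using hg 0
  rw [sum_epsilon_mul hM, ← Finset.sum_div, Finset.sum_add_distrib]
  have h1 := Finset.sum_range_succ (fun t => g t) M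
  rw [Finset.sum_range_succ', h0] at h1
  rw [two_mul, Finset.sum_range_add]
  simp_rw [add_comm M, hg]
  linarith

theorem cos_add_mul_pi_div {M : ℕ} (hM : 0 < M) (t : ℕ) :
    Real.cos ((t + M : ℕ) * Real.pi / M) = - Real.cos (t * Real.pi / M) := by
  have hM0 : (M : ℝ) ≠ 0 := by positivity
  rw [← Real.cos_add_pi]; congr 1; push_cast; field_simp

theorem sin_add_mul_pi_div {M : ℕ} (hM : 0 < M) (t : ℕ) :
    Real.sin ((t + M : ℕ) * Real.pi / M) = - Real.sin (t * Real.pi / M) := by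
  have hM0 : (M : ℝ) ≠ 0 := by positivity
  rw [← Real.sin_add_pi]; congr 1; push_cast; field_simp

theorem sum_circle_of_even {N a b : ℕ} (hN : 0 < N) (ha : Even a) (hb : Even b)
    (hab : a + b ≤ 2 * N) :
    Real.pi / (2 * N : ℕ) * ∑ t ∈ Finset.range (2 * (2 * N)),
      Real.cos (t * Real.pi / (2 * N : ℕ)) ^ a * Real.sin (t * Real.pi / (2 * N : ℕ)) ^ b =
      2 * (Real.Gamma (((a : ℝ) + 1) / 2) * Real.Gamma (((b : ℝ) + 1) / 2) /
        Real.Gamma (((a : ℝ) + b + 2) / 2)) := by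
  have hM : 0 < 2 * N := by omega
  have h := sum_clenshawWeight_cos_pow_mul_sin_pow_of_even (α := 0) hN ha hb hab
  simp only [clenshawWeight_zero, Nat.cast_zero, add_zero] at h
  rw [sum_range_two_mul_of_periodic hM, ← h, mul_left_comm, Finset.mul_sum]
  · congr 1
    refine Finset.sum_congr rfl fun u _ => ?_
    ring
  · intro t
    rw [cos_add_mul_pi_div hM, sin_add_mul_pi_div hM, ha.neg_pow, hb.neg_pow]

/-- If `a + b` is odd, antipodal nodes cancel. If both exponents are odd, the sum folds to twice the
trapezoidal sum on `[0, π]`, which vanishes by the reflection `θ ↦ π - θ`. -/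
theorem sum_circle_of_odd {M a b : ℕ} (hM : 0 < M) (hab : Odd a ∨ Odd b) :
    ∑ t ∈ Finset.range (2 * M), Real.cos (t * Real.pi / M) ^ a * Real.sin (t * Real.pi / M) ^ b =
      0 := by
  rcases Nat.even_or_odd (a + b) with h | h
  · have ha : Odd a := by
      rcases hab with h' | h'
      · exact h'
      · by_contra h''
        rw [Nat.not_odd_iff_even] at h''
        exact Nat.not_even_iff_odd.2 (h''.add_odd h') h
    rw [sum_range_two_mul_of_periodic hM]
    · have := sum_clenshawWeight_cos_pow_mul_sin_pow_of_odd hM ha 0 b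
      simp only [clenshawWeight_zero, mul_right_comm _ (Real.pi / M : ℝ)] at this
      rw [← Finset.sum_mul] at this
      have hp : (Real.pi / M : ℝ) ≠ 0 := by positivity
      rw [(mul_eq_zero.1 this).resolve_right hp, mul_zero]
    · intro t
      rw [cos_add_mul_pi_div hM, sin_add_mul_pi_div hM]
      rw [neg_pow, neg_pow (Real.sin _), mul_mul_mul_comm, ← pow_add, h.neg_one_pow, one_mul]
  · refine sum_range_two_mul_of_antiperiodic fun t => ?_
    rw [cos_add_mul_pi_div hM, sin_add_mul_pi_div hM]
    rw [neg_pow, neg_pow (Real.sin _), mul_mul_mul_comm, ← pow_add, h.neg_one_pow, neg_one_mul]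

/-! ### Moments of the surface measure -/

/-- The moment of order `a` of the measure `exp (- t ^ 2) dt`. -/
def gaussMoment (a : ℕ) : ℝ := if Even a then Real.Gamma (((a : ℝ) + 1) / 2) else 0

theorem integral_Ioi_pow_mul_exp_neg_sq (a : ℕ) :
    ∫ t in Set.Ioi (0 : ℝ), t ^ a * Real.exp (-t ^ 2) = Real.Gamma (((a : ℝ) + 1) / 2) / 2 := by
  have h := integral_rpow_mul_exp_neg_rpow (p := 2) (q := a) (by norm_num)
    (by have : (0 : ℝ) ≤ a := a.cast_nonneg
        linarith)
  simp only [Real.rpow_natCast, Real.rpow_two] at h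
  rw [h]; ring

theorem integral_pow_mul_exp_neg_sq (a : ℕ) :
    ∫ t : ℝ, t ^ a * Real.exp (-t ^ 2) = gaussMoment a := by
  rw [gaussMoment]
  split_ifs with ha
  · have h := integral_comp_abs (f := fun t : ℝ => t ^ a * Real.exp (-t ^ 2))
    simp only [sq_abs, ha.pow_abs] at h
    rw [h, integral_Ioi_pow_mul_exp_neg_sq]; ring
  · have h := MeasureTheory.integral_neg_eq_self (fun t : ℝ => t ^ a * Real.exp (-t ^ 2))
      MeasureTheory.volume
    simp only [(Nat.not_even_iff_odd.1 ha).neg_pow, even_two.neg_pow, neg_mul,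
      MeasureTheory.integral_neg] at h
    linarith

theorem integral_euclideanSpace_monomial_mul_exp {d : ℕ} (a : Fin d → ℕ) :
    ∫ x : EuclideanSpace ℝ (Fin d), (∏ i, x i ^ a i) * Real.exp (-‖x‖ ^ 2) =
      ∏ i, gaussMoment (a i) := by
  have h := (PiLp.volume_preserving_ofLp (Fin d)).integral_comp
    (MeasurableEquiv.toLp 2 (Fin d → ℝ)).symm.measurableEmbedding
    (fun y : Fin d → ℝ => ∏ i, (y i ^ a i * Real.exp (-y i ^ 2)))
  rw [MeasureTheory.integral_fintype_prod_volume_eq_prod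
    (fun i (t : ℝ) => t ^ a i * Real.exp (-t ^ 2))] at h
  simp_rw [integral_pow_mul_exp_neg_sq] at h
  rw [← h]
  refine MeasureTheory.integral_congr_ae (Filter.Eventually.of_forall fun x => ?_)
  simp only
  rw [Finset.prod_mul_distrib, ← Real.exp_sum, EuclideanSpace.real_norm_sq_eq,
    Finset.sum_neg_distrib]

theorem integral_volumeIoiPow (d : ℕ) (f : ℝ → ℝ) :
    ∫ r : Set.Ioi (0 : ℝ), f r ∂(MeasureTheory.Measure.volumeIoiPow d) =
      ∫ r in Set.Ioi (0 : ℝ), r ^ d * f r := by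
  simp only [MeasureTheory.Measure.volumeIoiPow, ENNReal.ofReal]
  rw [integral_withDensity_eq_integral_smul,
    MeasureTheory.integral_subtype_comap measurableSet_Ioi
      fun a : ℝ ↦ Real.toNNReal (a ^ d) • f a,
    MeasureTheory.setIntegral_congr_fun measurableSet_Ioi fun x hx ↦ ?_]
  · simp only [NNReal.smul_def, smul_eq_mul]
    rw [Real.coe_toNNReal _ (pow_nonneg (le_of_lt hx) _)]
  · exact (measurable_subtype_coe.pow_const _).real_toNNReal

instance (n : ℕ) : MeasureTheory.IsFiniteMeasure (surfaceMeasure n) :=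
  inferInstanceAs (MeasureTheory.IsFiniteMeasure
    (MeasureTheory.volume : MeasureTheory.Measure (EuclideanSpace ℝ (Fin (n + 1)))).toSphere)

/-- Polar coordinates: a monomial is homogeneous of degree `∑ a_i`, so it separates into its values
on the sphere and a power of the radius. The origin is removed as a null set. -/
theorem integral_monomial_mul_exp_eq_sphere {n : ℕ} (a : Fin (n + 1) → ℕ) :
    ∫ x : EuclideanSpace ℝ (Fin (n + 1)), (∏ i, x i ^ a i) * Real.exp (-‖x‖ ^ 2) =
      (∫ x : Sphere n, ∏ i, x.1 i ^ a i ∂(surfaceMeasure n)) *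
        ∫ r in Set.Ioi (0 : ℝ), r ^ n * (r ^ (∑ i, a i) * Real.exp (-r ^ 2)) := by
  have hd : Module.finrank ℝ (EuclideanSpace ℝ (Fin (n + 1))) - 1 = n := by simp
  rw [← integral_volumeIoiPow n (fun r => r ^ (∑ i, a i) * Real.exp (-r ^ 2))]
  have hp := (MeasureTheory.volume :
    MeasureTheory.Measure (EuclideanSpace ℝ (Fin (n + 1)))).measurePreserving_homeomorphUnitSphereProd
  rw [hd] at hp
  have h := hp.integral_comp (Homeomorph.measurableEmbedding _)
    (fun p => (∏ i, p.1.1 i ^ a i) * (p.2.1 ^ (∑ i, a i) * Real.exp (-p.2.1 ^ 2)))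
  have h3 := MeasureTheory.integral_prod_mul (μ := surfaceMeasure n)
    (ν := MeasureTheory.Measure.volumeIoiPow n)
    (fun x : Sphere n => ∏ i, x.1 i ^ a i)
    (fun r : Set.Ioi (0 : ℝ) => r.1 ^ (∑ i, a i) * Real.exp (-r.1 ^ 2))
  refine Eq.trans ?_ (h.trans h3)
  have h4 := MeasureTheory.integral_subtype_comap (μ := MeasureTheory.volume)
    (measurableSet_singleton (0 : EuclideanSpace ℝ (Fin (n + 1)))).compl
    fun x => (∏ i, x i ^ a i) * Real.exp (-‖x‖ ^ 2)
  rw [MeasureTheory.restrict_compl_singleton] at h4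
  rw [← h4]
  refine MeasureTheory.integral_congr_ae (Filter.Eventually.of_forall fun x => ?_)
  have hx : ‖x.1‖ ≠ 0 := norm_ne_zero_iff.2 x.2
  simp only [homeomorphUnitSphereProd_apply_fst_coe, homeomorphUnitSphereProd_apply_snd_coe,
    PiLp.smul_apply, smul_eq_mul, mul_pow]
  rw [← mul_assoc, Finset.prod_mul_distrib, Finset.prod_pow_eq_pow_sum, mul_right_comm _ _ (_ ^ _),
    ← mul_pow, inv_mul_cancel₀ hx, one_pow, one_mul]

theorem integral_sphere_monomial {n : ℕ} (a : Fin (n + 1) → ℕ) :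
    ∫ x : Sphere n, ∏ i, x.1 i ^ a i ∂(surfaceMeasure n) =
      2 * (∏ i, gaussMoment (a i)) / Real.Gamma ((((∑ i, a i : ℕ) : ℝ) + n + 1) / 2) := by
  have h := integral_monomial_mul_exp_eq_sphere a
  rw [integral_euclideanSpace_monomial_mul_exp] at h
  simp_rw [← mul_assoc, ← pow_add] at h
  rw [integral_Ioi_pow_mul_exp_neg_sq] at h
  have hG : Real.Gamma ((((∑ i, a i : ℕ) : ℝ) + n + 1) / 2) ≠ 0 :=
    (Real.Gamma_pos_of_pos (by positivity)).ne'
  rw [h, Nat.cast_add, add_comm (n : ℝ)]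
  field_simp

/-! ### The grid rule on monomials -/

/-- `sin ϑ_ν` divides every coordinate after the `ν`-th one, so its exponent collects all later
`a_i`. -/
theorem prod_sphericalVector_pow {d : ℕ} (a : Fin (d + 1 + 1) → ℕ) (ϑ : Fin d → ℝ) (φ : ℝ) :
    ∏ i, (sphericalVector (n := d + 1) ϑ φ) i ^ a i =
      (∏ ν : Fin d, Real.cos (ϑ ν) ^ a ν.castSucc.castSucc *
        Real.sin (ϑ ν) ^ (∑ i : Fin (d + 1 + 1) with ν.val < i.val, a i)) *
      (Real.cos φ ^ a (Fin.last d).castSucc * Real.sin φ ^ a (Fin.last (d + 1))) := by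
  simp only [sphericalVector, mul_pow]
  rw [Finset.prod_mul_distrib, Finset.prod_mul_distrib, mul_comm (∏ ν : Fin d, _ ^ _), mul_assoc]
  congr 1
  · simp_rw [← Finset.prod_pow_eq_pow_sum, ← Finset.prod_pow, Finset.prod_filter]
    exact Finset.prod_comm
  · rw [Fin.prod_univ_castSucc, Fin.prod_univ_castSucc]
    simp [mul_assoc]

theorem sum_gridIndex_mul {d j : ℕ} (f : Fin d → Fin (2 ^ j + 1) → ℝ) (g : Fin (2 ^ (j + 1)) → ℝ) :
    ∑ st : GridIndex (d + 1) j, (∏ ν : Fin d, f ν (st.1 ν)) * g st.2 =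
      (∏ ν, ∑ s, f ν s) * ∑ t, g t := by
  rw [Fintype.sum_prod_type, Finset.prod_univ_sum, Fintype.piFinset_univ, Finset.sum_mul_sum]
  rfl

theorem sum_grid_monomial_eq_prod {d j : ℕ} (hd : 2 ≤ d + 1) (a : Fin (d + 1 + 1) → ℕ) :
    ∑ st : GridIndex (d + 1) j,
      (∏ ν : Fin d, chiWeight (2 ^ j) (d + 1 - ((ν : ℕ) + 1)) (st.1 ν : ℕ)) *
        ∏ i, (gridPoint hd j st).1 i ^ a i =
    (∏ ν : Fin d, ∑ u ∈ Finset.range (2 ^ j + 1), clenshawWeight (2 ^ j) (d - ν) u *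
      (Real.cos (u * Real.pi / (2 ^ j : ℕ)) ^ a ν.castSucc.castSucc *
        Real.sin (u * Real.pi / (2 ^ j : ℕ)) ^
          (∑ i : Fin (d + 1 + 1) with ν.val < i.val, a i))) *
    ∑ t ∈ Finset.range (2 * 2 ^ j), Real.cos (t * Real.pi / (2 ^ j : ℕ)) ^ a (Fin.last d).castSucc *
      Real.sin (t * Real.pi / (2 ^ j : ℕ)) ^ a (Fin.last (d + 1)) := by
  rw [show 2 * 2 ^ j = 2 ^ (j + 1) by ring]
  simp only [Finset.sum_range]
  rw [← sum_gridIndex_mul]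
  refine Finset.sum_congr rfl fun st _ => ?_
  simp only [gridPoint, sphericalPoint]
  rw [prod_sphericalVector_pow, ← mul_assoc, ← Finset.prod_mul_distrib]
  congr 1
  · refine Finset.prod_congr rfl fun ν _ => ?_
    have := ν.2
    rw [chiWeight_eq_clenshawWeight (by omega), show d + 1 - ((ν : ℕ) + 1) = d - ν by omega]
    push_cast
    rfl
  · push_cast
    rfl

theorem sum_filter_le_eq_add {m : ℕ} (a : Fin m → ℕ) (i : Fin m) :
    ∑ k : Fin m with i.val ≤ k.val, a k = a i + ∑ k : Fin m with i.val < k.val, a k := by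
  have : (Finset.univ.filter fun k : Fin m => i.val ≤ k.val) =
      insert i (Finset.univ.filter fun k : Fin m => i.val < k.val) := by
    ext k
    simp only [Finset.mem_filter, Finset.mem_univ, true_and, Finset.mem_insert, Fin.ext_iff]
    omega
  rw [this, Finset.sum_insert (by simp)]

/-- The exponent `d - ν` of the sine weight is what makes the numerator of the `ν`-th Beta value
equal to the denominator of the next one; `G` below is the common sequence. -/
theorem prod_Gamma_telescope {d : ℕ} (a : Fin (d + 1 + 1) → ℕ) :
    ∏ ν : Fin d,
      Real.Gamma (((∑ i : Fin (d + 1 + 1) with ν.val < i.val, a i : ℕ) + (d - ν : ℕ) + 1 : ℝ) / 2) /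
      Real.Gamma ((a ν.castSucc.castSucc + (∑ i : Fin (d + 1 + 1) with ν.val < i.val, a i : ℕ) +
        (d - ν : ℕ) + 2 : ℝ) / 2) =
    Real.Gamma ((a (Fin.last d).castSucc + a (Fin.last (d + 1)) + 2 : ℝ) / 2) /
      Real.Gamma (((∑ i, a i : ℕ) + (d + 1 : ℕ) + 1 : ℝ) / 2) := by
  set G : ℕ → ℝ := fun k => Real.Gamma
    (((∑ i : Fin (d + 1 + 1) with k ≤ i.val, a i : ℕ) + (d : ℝ) + 2 - k) / 2) with hG
  have hpos : ∀ k, k ≤ d → G k ≠ 0 := by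
    intro k hk
    have : (k : ℝ) ≤ d := by exact_mod_cast hk
    have h0 : (0 : ℝ) ≤ ((∑ i : Fin (d + 1 + 1) with k ≤ i.val, a i : ℕ) : ℝ) := Nat.cast_nonneg _
    exact (Real.Gamma_pos_of_pos (by linarith)).ne'
  have htel : ∀ k, k ≤ d → ∏ i ∈ Finset.range k, G (i + 1) / G i = G k / G 0 := by
    intro k
    induction k with
    | zero => intro _; simp [hpos 0 (Nat.zero_le _)]
    | succ k ih =>
      intro hk
      rw [Finset.prod_range_succ, ih (by omega)]
      have := hpos k (by omega)
      have := hpos 0 (by omega)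
      field_simp
  have hstep : ∀ ν : Fin d, Real.Gamma
      (((∑ i : Fin (d + 1 + 1) with ν.val < i.val, a i : ℕ) + (d - ν : ℕ) + 1 : ℝ) / 2) /
      Real.Gamma ((a ν.castSucc.castSucc + (∑ i : Fin (d + 1 + 1) with ν.val < i.val, a i : ℕ) +
        (d - ν : ℕ) + 2 : ℝ) / 2) = G (ν + 1) / G ν := by
    intro ν
    have h1 := sum_filter_le_eq_add a ν.castSucc.castSucc
    simp only [Fin.val_castSucc] at h1
    simp only [hG, h1, Nat.succ_le_iff, Nat.cast_sub ν.2.le, Nat.cast_add, Nat.cast_one]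
    congr 2 <;> ring
  rw [Finset.prod_congr rfl fun ν _ => hstep ν, Fin.prod_univ_eq_prod_range
    (fun i => G (i + 1) / G i) d, htel d le_rfl]
  have hd : ∑ i : Fin (d + 1 + 1) with d ≤ i.val, a i =
      a (Fin.last d).castSucc + a (Fin.last (d + 1)) := by
    rw [Finset.sum_filter, Fin.sum_univ_castSucc, Fin.sum_univ_castSucc]
    have : ∀ i : Fin d, ¬ d ≤ i.val := fun i => by omega
    simp [this]
  simp only [hG, hd]
  congr 2
  · push_cast; ring
  · simp; ring

theorem grid_monomial {n j : ℕ} (hn : 2 ≤ n) (hj : 1 ≤ j) (a : Fin (n + 1) → ℕ)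
    (ha : ∑ i, a i ≤ 2 ^ j) :
    Real.pi / 2 ^ j * ∑ st : GridIndex n j,
      (∏ ν : Fin (n - 1), chiWeight (2 ^ j) (n - ((ν : ℕ) + 1)) (st.1 ν : ℕ)) *
        ∏ i, (gridPoint hn j st).1 i ^ a i =
    ∫ x : Sphere n, ∏ i, x.1 i ^ a i ∂(surfaceMeasure n) := by
  obtain ⟨d, rfl⟩ : ∃ d, n = d + 1 := ⟨n - 1, by omega⟩
  rw [integral_sphere_monomial]
  refine (congrArg (Real.pi / 2 ^ j * ·) (sum_grid_monomial_eq_prod hn a)).trans ?_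
  obtain ⟨N, hN0, hN⟩ : ∃ N, 0 < N ∧ 2 ^ j = 2 * N :=
    ⟨2 ^ (j - 1), by positivity, by rw [← pow_succ', Nat.sub_add_cancel hj]⟩
  have hc : (2 : ℝ) ^ j = (2 * N : ℕ) := by exact_mod_cast hN
  rw [hN] at ha
  simp only [hN, hc]
  by_cases hev : ∀ i, Even (a i)
  · have hle : ∀ ν : Fin d, a ν.castSucc.castSucc +
        ∑ i : Fin (d + 1 + 1) with ν.val < i.val, a i ≤ 2 * N := by
      intro ν
      have h1 := sum_filter_le_eq_add a ν.castSucc.castSucc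
      simp only [Fin.val_castSucc] at h1
      rw [← h1]
      exact (Finset.sum_le_sum_of_subset (Finset.filter_subset _ _)).trans ha
    have hle' : a (Fin.last d).castSucc + a (Fin.last (d + 1)) ≤ 2 * N := by
      rw [Fin.sum_univ_castSucc, Fin.sum_univ_castSucc] at ha
      omega
    have hfac : ∀ ν : Fin d, ∑ u ∈ Finset.range (2 * N + 1), clenshawWeight (2 * N) (d - ν) u *
        (Real.cos (u * Real.pi / (2 * N : ℕ)) ^ a ν.castSucc.castSucc *
        Real.sin (u * Real.pi / (2 * N : ℕ)) ^
          (∑ i : Fin (d + 1 + 1) with ν.val < i.val, a i)) = _ := fun ν =>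
      sum_clenshawWeight_cos_pow_mul_sin_pow_of_even hN0 (hev _)
        (Finset.even_sum _ fun i _ => hev i) (hle ν)
    rw [Finset.prod_congr rfl fun ν _ => hfac ν, mul_left_comm,
      sum_circle_of_even hN0 (hev _) (hev _) hle']
    simp_rw [mul_div_assoc]
    rw [Finset.prod_mul_distrib, prod_Gamma_telescope]
    simp only [gaussMoment, hev, if_true]
    rw [Fin.prod_univ_castSucc, Fin.prod_univ_castSucc]
    -- The Gamma value left over by the telescoping is the denominator of the circle sum.
    have h0 : Real.Gamma ((a (Fin.last d).castSucc + a (Fin.last (d + 1)) + 2 : ℝ) / 2) ≠ 0 :=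
      (Real.Gamma_pos_of_pos (by positivity)).ne'
    field_simp
  · push Not at hev
    obtain ⟨i, hi⟩ := hev
    have hr : ∏ i, gaussMoment (a i) = 0 :=
      Finset.prod_eq_zero (Finset.mem_univ i) (if_neg hi)
    rw [hr, mul_zero, zero_div]
    rw [Nat.not_even_iff_odd] at hi
    have hM : 0 < 2 * N := by omega
    -- An odd exponent of one of the first `d` coordinates kills the factor of its own colatitude;
    -- one of the last two kills the circle sum.
    by_cases h : i.val < d
    · have hi' : i = (⟨i, h⟩ : Fin d).castSucc.castSucc := rfl
      rw [hi'] at hi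
      rw [Finset.prod_eq_zero (Finset.mem_univ (⟨i, h⟩ : Fin d))
        (sum_clenshawWeight_cos_pow_mul_sin_pow_of_odd hM hi _ _), zero_mul, mul_zero]
    · rw [sum_circle_of_odd hM, mul_zero, mul_zero]
      have h2 := i.2
      rcases (by omega : i.val = d ∨ i.val = d + 1) with h3 | h3
      · left; convert hi; exact Fin.ext (by simp [h3])
      · right; convert hi; exact Fin.ext (by simp [h3])

/-! ### Restrictions of polynomials of bounded degree -/

/-- The restrictions to the sphere of the complex polynomials of degree at most `d`. -/
def polySpace (n d : ℕ) : Submodule ℂ (Sphere n → ℂ) :=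
  (MvPolynomial.restrictTotalDegree (Fin (n + 1)) ℂ d).map (restrictToSphere n)

theorem restrictToSphere_apply {n : ℕ} (p : MvPolynomial (Fin (n + 1)) ℂ) (x : Sphere n) :
    restrictToSphere n p x = MvPolynomial.aeval (fun i => ((x.1 i : ℝ) : ℂ)) p := rfl

theorem mem_polySpace {n d : ℕ} {f : Sphere n → ℂ} :
    f ∈ polySpace n d ↔ ∃ p : MvPolynomial (Fin (n + 1)) ℂ,
      p.totalDegree ≤ d ∧ ∀ x, MvPolynomial.aeval (fun i => ((x.1 i : ℝ) : ℂ)) p = f x := by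
  simp only [polySpace, Submodule.mem_map, MvPolynomial.mem_restrictTotalDegree, funext_iff,
    restrictToSphere_apply]

theorem polySpace_mono {n d e : ℕ} (h : d ≤ e) : polySpace n d ≤ polySpace n e := by
  intro f hf
  obtain ⟨p, hp, hf⟩ := mem_polySpace.1 hf
  exact mem_polySpace.2 ⟨p, hp.trans h, hf⟩

theorem const_mem_polySpace {n : ℕ} (d : ℕ) (c : ℂ) :
    (fun _ : Sphere n => c) ∈ polySpace n d :=
  mem_polySpace.2 ⟨MvPolynomial.C c, by simp, fun x => by simp⟩

theorem coord_mem_polySpace {n : ℕ} (i : Fin (n + 1)) :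
    (fun x : Sphere n => ((x.1 i : ℝ) : ℂ)) ∈ polySpace n 1 :=
  mem_polySpace.2 ⟨MvPolynomial.X i, by simp, fun x => by simp⟩

theorem mul_mem_polySpace {n d e : ℕ} {f g : Sphere n → ℂ} (hf : f ∈ polySpace n d)
    (hg : g ∈ polySpace n e) : (fun x => f x * g x) ∈ polySpace n (d + e) := by
  obtain ⟨p, hp, hf⟩ := mem_polySpace.1 hf
  obtain ⟨q, hq, hg⟩ := mem_polySpace.1 hg
  refine mem_polySpace.2 ⟨p * q, (MvPolynomial.totalDegree_mul _ _).trans (by omega), fun x => ?_⟩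
  rw [map_mul, hf, hg]

theorem pow_mem_polySpace {n d : ℕ} {f : Sphere n → ℂ} (hf : f ∈ polySpace n d) (m : ℕ) :
    (fun x => f x ^ m) ∈ polySpace n (m * d) := by
  obtain ⟨p, hp, hf⟩ := mem_polySpace.1 hf
  refine mem_polySpace.2 ⟨p ^ m, (MvPolynomial.totalDegree_pow _ _).trans
    (Nat.mul_le_mul_left _ hp), fun x => ?_⟩
  rw [map_pow, hf]

theorem prod_mem_polySpace {n : ℕ} {ι : Type*} (s : Finset ι) (d : ι → ℕ)
    {f : ι → Sphere n → ℂ} (hf : ∀ i, f i ∈ polySpace n (d i)) :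
    (fun x => ∏ i ∈ s, f i x) ∈ polySpace n (∑ i ∈ s, d i) := by
  choose p hp hf using fun i => mem_polySpace.1 (hf i)
  refine mem_polySpace.2 ⟨∏ i ∈ s, p i, (MvPolynomial.totalDegree_finsetProd _ _).trans
    (Finset.sum_le_sum fun i _ => hp i), fun x => ?_⟩
  rw [map_prod]
  exact Finset.prod_congr rfl fun i _ => hf i x

theorem sum_mem_polySpace {n d : ℕ} {ι : Type*} (s : Finset ι)
    {f : ι → Sphere n → ℂ} (hf : ∀ i ∈ s, f i ∈ polySpace n d) :
    (fun x => ∑ i ∈ s, f i x) ∈ polySpace n d := by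
  have := Submodule.sum_mem _ hf
  convert this using 1
  ext x
  simp

/-- The coordinates are real, so conjugating the coefficients conjugates the function. -/
theorem conj_mem_polySpace {n d : ℕ} {f : Sphere n → ℂ} (hf : f ∈ polySpace n d) :
    (fun x => conj (f x)) ∈ polySpace n d := by
  obtain ⟨p, hp, hf⟩ := mem_polySpace.1 hf
  refine mem_polySpace.2 ⟨MvPolynomial.map (starRingEnd ℂ) p,
    (Finset.sup_mono (MvPolynomial.support_map_subset _ _)).trans hp, fun x => ?_⟩
  rw [← hf x, MvPolynomial.aeval_def, MvPolynomial.aeval_def, Algebra.algebraMap_self,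
    MvPolynomial.eval₂_map, MvPolynomial.hom_eval₂]
  congr 1
  ext i
  simp

theorem samplingSpace_le_polySpace (n j : ℕ) :
    samplingSpace n j ≤ polySpace n (2 ^ (j - 1) - 1) := by
  refine iSup₂_le fun l hl => Submodule.map_mono fun p hp => ?_
  rw [MvPolynomial.mem_restrictTotalDegree]
  have := Finset.mem_range.1 hl
  have h : p.IsHomogeneous l := (MvPolynomial.mem_homogeneousSubmodule _ _).1 hp.1
  exact h.totalDegree_le.trans (by omega)

theorem integrable_of_mem_polySpace {n d : ℕ} {f : Sphere n → ℂ} (hf : f ∈ polySpace n d) :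
    MeasureTheory.Integrable f (surfaceMeasure n) := by
  obtain ⟨p, -, hf⟩ := mem_polySpace.1 hf
  obtain rfl : (fun x : Sphere n => MvPolynomial.aeval (fun i => ((x.1 i : ℝ) : ℂ)) p) = f :=
    funext hf
  refine Continuous.integrable_of_hasCompactSupport ?_ (HasCompactSupport.of_compactSpace _)
  simp only [MvPolynomial.aeval_def, MvPolynomial.eval₂_eq']
  fun_prop

theorem grid_polynomial {n j : ℕ} (hn : 2 ≤ n) (hj : 1 ≤ j) {f : Sphere n → ℂ}
    (hf : f ∈ polySpace n (2 ^ j)) :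
    ((Real.pi / 2 ^ j : ℝ) : ℂ) * ∑ st : GridIndex n j,
      ((∏ ν : Fin (n - 1), chiWeight (2 ^ j) (n - ((ν : ℕ) + 1)) (st.1 ν : ℕ) : ℝ) : ℂ) *
        f (gridPoint hn j st) =
    ∫ x : Sphere n, f x ∂(surfaceMeasure n) := by
  obtain ⟨p, hp, hf⟩ := mem_polySpace.1 hf
  have hexp : ∀ x, f x = ∑ s ∈ p.support, p.coeff s * ((∏ i, x.1 i ^ s i : ℝ) : ℂ) := by
    intro x
    rw [← hf, MvPolynomial.aeval_def, MvPolynomial.eval₂_eq']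
    push_cast
    rfl
  have hmono : ∀ s : Fin (n + 1) →₀ ℕ,
      (fun x : Sphere n => p.coeff s * ((∏ i, x.1 i ^ s i : ℝ) : ℂ)) ∈
        polySpace n (0 + ∑ i, s i * 1) := by
    intro s
    push_cast
    exact mul_mem_polySpace (const_mem_polySpace 0 _)
      (prod_mem_polySpace _ _ fun i => pow_mem_polySpace (coord_mem_polySpace i) _)
  simp_rw [hexp]
  rw [MeasureTheory.integral_finsetSum _ fun s _ => integrable_of_mem_polySpace (hmono s)]
  simp_rw [Finset.mul_sum]
  rw [Finset.sum_comm]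
  refine Finset.sum_congr rfl fun s hs => ?_
  have hdeg : ∑ i, s i ≤ 2 ^ j := by
    have := (MvPolynomial.le_totalDegree hs).trans hp
    rwa [Finsupp.sum_fintype _ _ fun _ => rfl] at this
  rw [MeasureTheory.integral_const_mul, integral_complex_ofReal, ← grid_monomial hn hj _ hdeg]
  push_cast
  simp_rw [Finset.mul_sum]
  refine Finset.sum_congr rfl fun st _ => ?_
  ring

/-! ### Hyperspherical harmonics as polynomials -/

/-- The homogeneous form `s ^ (l / 2) * C_l^lam (x / √s)` of the Gegenbauer polynomial. -/
def gegenbauerHom (l : ℕ) (lam x s : ℝ) : ℝ :=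
  ∑ m ∈ Finset.range (l / 2 + 1),
    (-1) ^ m * (ascPochhammer ℝ (l - m)).eval lam
      / ((m.factorial : ℝ) * ((l - 2 * m).factorial : ℝ)) * ((2 * x) ^ (l - 2 * m) * s ^ m)

theorem gegenbauerHom_sq (l : ℕ) (lam x : ℝ) {r : ℝ} (hr : r ≠ 0) :
    gegenbauerHom l lam x (r ^ 2) = r ^ l * gegenbauer l lam (x / r) := by
  rw [gegenbauerHom, gegenbauer, Finset.mul_sum]
  refine Finset.sum_congr rfl fun m hm => ?_
  have hm' : 2 * m ≤ l := by have := Finset.mem_range.1 hm; omega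
  obtain ⟨e, rfl⟩ := Nat.exists_eq_add_of_le hm'
  rw [Nat.add_sub_cancel_left, pow_add, pow_mul, mul_div_assoc', div_pow]
  field_simp

theorem gegenbauerHom_zero_zero {l : ℕ} (hl : l ≠ 0) (lam : ℝ) : gegenbauerHom l lam 0 0 = 0 := by
  rw [gegenbauerHom]
  refine Finset.sum_eq_zero fun m _ => ?_
  rcases eq_or_ne m 0 with rfl | hm
  · simp [hl]
  · simp [hm]

theorem gegenbauer_zero (lam t : ℝ) : gegenbauer 0 lam t = 1 := by simp [gegenbauer]

theorem gegenbauerHom_zero (lam x s : ℝ) : gegenbauerHom 0 lam x s = 1 := by simp [gegenbauerHom]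

/-- The squared length of `(x_ν, x_{ν+1}, …)`. -/
def tailSq {n : ℕ} (ν : ℕ) (x : Sphere n) : ℝ := ∑ i : Fin (n + 1) with ν ≤ i.val, x.1 i ^ 2

theorem tailSq_nonneg {n : ℕ} (ν : ℕ) (x : Sphere n) : 0 ≤ tailSq ν x :=
  Finset.sum_nonneg fun _ _ => sq_nonneg _

theorem tailSq_zero {n : ℕ} (x : Sphere n) : tailSq 0 x = 1 := by
  have h := x.2
  rw [mem_sphere_zero_iff_norm, ← sq_eq_sq₀ (norm_nonneg _) zero_le_one, one_pow,
    EuclideanSpace.real_norm_sq_eq] at h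
  simpa [tailSq] using h

theorem tailSq_eq_add {n : ℕ} (i : Fin (n + 1)) (x : Sphere n) :
    tailSq i x = x.1 i ^ 2 + tailSq (i + 1) x := by
  have : (Finset.univ.filter fun k : Fin (n + 1) => i.val ≤ k.val) =
      insert i (Finset.univ.filter fun k : Fin (n + 1) => i.val + 1 ≤ k.val) := by
    ext k
    simp only [Finset.mem_filter, Finset.mem_univ, true_and, Finset.mem_insert, Fin.ext_iff]
    omega
  rw [tailSq, tailSq, this, Finset.sum_insert (by simp)]

theorem cos_colatitude {n : ℕ} (x : Sphere n) (ν : Fin (n - 1)) :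
    Real.cos (colatitude x ν) = x.1 ⟨ν, by omega⟩ / Real.sqrt (tailSq ν x) ∧
      Real.sin (colatitude x ν) =
        Real.sqrt (1 - (x.1 ⟨ν, by omega⟩ / Real.sqrt (tailSq ν x)) ^ 2) := by
  have h := tailSq_eq_add (⟨ν, by omega⟩ : Fin (n + 1)) x
  simp only at h
  have h1 : (x.1 ⟨ν, by omega⟩ / Real.sqrt (tailSq ν x)) ^ 2 ≤ 1 := by
    rw [div_pow, Real.sq_sqrt (tailSq_nonneg _ _)]
    refine div_le_one_of_le₀ ?_ (tailSq_nonneg _ _)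
    rw [h]
    linarith [tailSq_nonneg (ν + 1) x]
  have h2 := abs_le.1 ((sq_le_one_iff_abs_le_one _).1 h1)
  exact ⟨Real.cos_arccos h2.1 h2.2, Real.sin_arccos _⟩

/-- Of the `m + k` factors `r_ν`, `m` homogenize the Gegenbauer polynomial and `k` turn `sin ϑ_ν`
into `r_{ν+1}`. -/
theorem sqrt_tailSq_pow_mul_gegenbauer {n : ℕ} (x : Sphere n) (ν : Fin (n - 1)) (m k : ℕ)
    (lam : ℝ) :
    Real.sqrt (tailSq ν x) ^ (m + k) *
      (gegenbauer m lam (Real.cos (colatitude x ν)) * Real.sin (colatitude x ν) ^ k) =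
    gegenbauerHom m lam (x.1 ⟨ν, by omega⟩) (tailSq ν x) * Real.sqrt (tailSq (ν + 1) x) ^ k := by
  obtain ⟨hc, hs⟩ := cos_colatitude x ν
  rw [hc, hs]
  have h := tailSq_eq_add (⟨ν, by omega⟩ : Fin (n + 1)) x
  simp only at h
  have hsq := Real.sq_sqrt (tailSq_nonneg ν x)
  -- Where the colatitude is undetermined, both sides vanish unless `m = k = 0`, when both are `1`.
  by_cases h0 : Real.sqrt (tailSq ν x) = 0
  · have h1 : tailSq ν x = 0 := by rw [← hsq, h0]; norm_num
    have h2 : x.1 ⟨ν, by omega⟩ = 0 := by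
      rw [← sq_eq_zero_iff]
      linarith [tailSq_nonneg (ν + 1) x, sq_nonneg (x.1 (⟨ν, by omega⟩ : Fin (n + 1)))]
    have h3 : tailSq (ν + 1) x = 0 := by
      rw [h2] at h; linarith
    rw [h1, h2, h3]
    rcases eq_or_ne k 0 with rfl | hk
    · rcases eq_or_ne m 0 with rfl | hm
      · simp [gegenbauer_zero, gegenbauerHom_zero]
      · simp [hm, gegenbauerHom_zero_zero hm]
    · simp [hk]
  · have h1 : Real.sqrt (tailSq ν x) *
        Real.sqrt (1 - (x.1 ⟨ν, by omega⟩ / Real.sqrt (tailSq ν x)) ^ 2) =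
        Real.sqrt (tailSq (ν + 1) x) := by
      rw [← Real.sqrt_mul (tailSq_nonneg _ _), div_pow, hsq]
      congr 1
      have : tailSq ν x ≠ 0 := fun h => h0 (by rw [h, Real.sqrt_zero])
      field_simp
      linarith
    rw [← h1, mul_pow]
    conv_rhs => rw [← hsq]
    rw [gegenbauerHom_sq _ _ _ h0]
    simp only [hsq]
    ring

/-- Stated without quotients because the radii `r ν` may vanish. -/
theorem prod_telescope : ∀ {N : ℕ} (r : ℕ → ℝ) (o : Fin (N + 1) → ℕ) (T H : Fin N → ℝ),
    (∀ ν : Fin N, r ν ^ o ν.castSucc * T ν = H ν * r (ν + 1) ^ o ν.succ) →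
    r 0 ^ o 0 * ∏ ν, T ν = (∏ ν, H ν) * r N ^ o (Fin.last N)
  | 0, r, o, T, H, _ => by simp
  | N + 1, r, o, T, H, h => by
    have ih := prod_telescope r (fun i => o i.castSucc) (fun ν => T ν.castSucc)
      (fun ν => H ν.castSucc) (fun ν => by simpa using h ν.castSucc)
    have hl := h (Fin.last N)
    simp only [Fin.castSucc_zero, Fin.val_last, Fin.succ_last] at ih hl
    rw [Fin.prod_univ_castSucc, Fin.prod_univ_castSucc, ← mul_assoc, ih, mul_assoc, hl, mul_assoc]

theorem sum_telescope : ∀ {N : ℕ} (o : Fin (N + 1) → ℕ),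
    (∀ ν : Fin N, o ν.succ ≤ o ν.castSucc) →
    ∑ ν : Fin N, (o ν.castSucc - o ν.succ) + o (Fin.last N) = o 0
  | 0, o, _ => by simp
  | N + 1, o, h => by
    have ih := sum_telescope (fun i => o i.castSucc) (fun ν => by simpa using h ν.castSucc)
    have hl := h (Fin.last N)
    simp only [Fin.castSucc_zero, Fin.succ_last] at ih hl
    rw [Fin.sum_univ_castSucc]
    simp only [Fin.succ_castSucc, Fin.succ_last, Nat.succ_eq_add_one] at ih hl ⊢
    omega

/-- The last radius left by the telescoping is `|x_n + i x_{n+1}|`; its power completes the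
azimuthal exponential to a polynomial. -/
theorem norm_pow_mul_exp_arg (z : ℂ) (k : ℤ) :
    ((‖z‖ ^ k.natAbs : ℝ) : ℂ) * Complex.exp (Complex.I * k * z.arg) =
      (if 0 ≤ k then z else conj z) ^ k.natAbs := by
  have hz := Complex.norm_mul_exp_arg_mul_I z
  split_ifs with hk
  · have hk' : (k : ℂ) = k.natAbs := by
      rw [← Int.cast_natCast, Int.natAbs_of_nonneg hk]
    conv_rhs => rw [← hz]
    rw [mul_pow, ← Complex.exp_nat_mul, hk']
    push_cast
    ring_nf
  · have hk' : (k : ℂ) = -k.natAbs := by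
      rw [← Int.cast_natCast, Int.ofNat_natAbs_of_nonpos (by omega)]; simp
    conv_rhs => rw [← hz]
    rw [map_mul, ← Complex.exp_conj, mul_pow, ← Complex.exp_nat_mul, hk']
    simp only [Complex.conj_ofReal, map_mul, Complex.conj_I]
    push_cast
    ring_nf

theorem gegenbauerHom_mem_polySpace {n : ℕ} (m : ℕ) (lam : ℝ) (i : Fin (n + 1)) (ν : ℕ) :
    (fun x : Sphere n => ((gegenbauerHom m lam (x.1 i) (tailSq ν x) : ℝ) : ℂ)) ∈
      polySpace n m := by
  simp only [gegenbauerHom, Complex.ofReal_sum]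
  refine sum_mem_polySpace _ fun p hp => ?_
  have hp' := Finset.mem_range.1 hp
  simp only [Complex.ofReal_mul _ (_ * _), Complex.ofReal_mul (_ ^ _), Complex.ofReal_pow]
  -- The degree is exactly `m`, since `p ≤ m / 2` and the squared radius has degree two.
  refine polySpace_mono (d := 0 + ((m - 2 * p) * (0 + 1) + p * 2)) (by omega) ?_
  refine mul_mem_polySpace (const_mem_polySpace 0 _) (mul_mem_polySpace
    (pow_mem_polySpace ?_ _) (pow_mem_polySpace ?_ _))
  · simp only [Complex.ofReal_mul]
    exact mul_mem_polySpace (const_mem_polySpace 0 _) (coord_mem_polySpace i)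
  · simp only [tailSq, Complex.ofReal_sum, Complex.ofReal_pow]
    exact sum_mem_polySpace _ fun k _ => pow_mem_polySpace (coord_mem_polySpace k) 2

/-- The projection of the sphere to the plane of the last two coordinates. -/
def lastPlane {n : ℕ} (hn : 2 ≤ n) (x : Sphere n) : ℂ :=
  ⟨x.1 ⟨n - 1, by omega⟩, x.1 ⟨n, by omega⟩⟩

theorem sqrt_tailSq_eq_norm_lastPlane {n : ℕ} (hn : 2 ≤ n) (x : Sphere n) :
    Real.sqrt (tailSq (n - 1) x) = ‖lastPlane hn x‖ := by
  have h1 := tailSq_eq_add (⟨n - 1, by omega⟩ : Fin (n + 1)) x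
  have h2 := tailSq_eq_add (⟨n, by omega⟩ : Fin (n + 1)) x
  have h3 : tailSq (n + 1) x = 0 := by
    rw [tailSq, Finset.filter_false_of_mem (fun i _ => by omega), Finset.sum_empty]
  simp only [h3, Nat.sub_add_cancel (by omega : 1 ≤ n)] at h1 h2
  rw [Complex.norm_def, Complex.normSq_apply, h1, h2, lastPlane]
  congr 1
  ring

theorem lastPlane_mem_polySpace {n : ℕ} (hn : 2 ≤ n) : lastPlane hn ∈ polySpace n 1 := by
  have h1 := Submodule.add_mem _ (coord_mem_polySpace (⟨n - 1, by omega⟩ : Fin (n + 1)))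
    (Submodule.smul_mem _ Complex.I (coord_mem_polySpace (⟨n, by omega⟩ : Fin (n + 1))))
  convert h1 using 1
  ext x
  apply Complex.ext <;> simp [lastPlane]

theorem orders_last {n : ℕ} (hn : 2 ≤ n) (l : ℕ) (k : Fin (n - 1) → ℤ) :
    orders l k (Fin.last (n - 1)) = (k ⟨n - 2, by omega⟩).natAbs := by
  obtain ⟨d, rfl⟩ : ∃ d, n = d + 2 := ⟨n - 2, by omega⟩
  rfl

/-- Since `r_1 = 1` on the sphere, the factor `r_1 ^ l` can be inserted for free; it is passed down
the chain of colatitudes and ends as the power of the last radius. -/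
theorem harmonicUnnormalized_eq {n : ℕ} (hn : 2 ≤ n) (l : ℕ) (k : Fin (n - 1) → ℤ)
    (hk : ∀ ν : Fin (n - 1), orders l k ν.succ ≤ orders l k ν.castSucc) (x : Sphere n) :
    harmonicUnnormalized hn l k x =
      (∏ ν : Fin (n - 1), ((gegenbauerHom (orders l k ν.castSucc - orders l k ν.succ)
        (((n : ℝ) - ((ν : ℕ) + 1)) / 2 + orders l k ν.succ)
        (x.1 ⟨ν, by omega⟩) (tailSq ν x) : ℝ) : ℂ)) *
      (if 0 ≤ k ⟨n - 2, by omega⟩ then lastPlane hn x else conj (lastPlane hn x)) ^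
        (k ⟨n - 2, by omega⟩).natAbs := by
  have h := prod_telescope (fun ν => Real.sqrt (tailSq ν x)) (orders l k)
    (fun ν => gegenbauer (orders l k ν.castSucc - orders l k ν.succ)
      (((n : ℝ) - ((ν : ℕ) + 1)) / 2 + orders l k ν.succ) (Real.cos (colatitude x ν)) *
        Real.sin (colatitude x ν) ^ orders l k ν.succ)
    (fun ν => gegenbauerHom (orders l k ν.castSucc - orders l k ν.succ)
      (((n : ℝ) - ((ν : ℕ) + 1)) / 2 + orders l k ν.succ)
      (x.1 ⟨ν, by omega⟩) (tailSq ν x)) fun ν => by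
    have := sqrt_tailSq_pow_mul_gegenbauer x ν (orders l k ν.castSucc - orders l k ν.succ)
      (orders l k ν.succ) (((n : ℝ) - ((ν : ℕ) + 1)) / 2 + orders l k ν.succ)
    rw [Nat.sub_add_cancel (hk ν)] at this
    exact this
  rw [tailSq_zero, Real.sqrt_one, one_pow, one_mul, sqrt_tailSq_eq_norm_lastPlane hn,
    orders_last hn] at h
  rw [harmonicUnnormalized, h, ← norm_pow_mul_exp_arg]
  push_cast
  rw [mul_assoc]
  rfl

theorem harmonicUnnormalized_mem_polySpace {n : ℕ} (hn : 2 ≤ n) (l : ℕ) (k : Fin (n - 1) → ℤ)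
    (hk : ∀ ν : Fin (n - 1), orders l k ν.succ ≤ orders l k ν.castSucc) :
    harmonicUnnormalized hn l k ∈ polySpace n l := by
  have hz : (fun x => if 0 ≤ k ⟨n - 2, by omega⟩ then lastPlane hn x
      else conj (lastPlane hn x)) ∈ polySpace n 1 := by
    split_ifs
    · exact lastPlane_mem_polySpace hn
    · exact conj_mem_polySpace (lastPlane_mem_polySpace hn)
  have hG : ∀ ν : Fin (n - 1), (fun x : Sphere n =>
      ((gegenbauerHom (orders l k ν.castSucc - orders l k ν.succ)
        (((n : ℝ) - ((ν : ℕ) + 1)) / 2 + orders l k ν.succ)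
        (x.1 ⟨ν, by omega⟩) (tailSq ν x) : ℝ) : ℂ)) ∈
      polySpace n (orders l k ν.castSucc - orders l k ν.succ) :=
    fun ν => gegenbauerHom_mem_polySpace _ _ _ _
  have h := mul_mem_polySpace (prod_mem_polySpace Finset.univ _ hG)
    (pow_mem_polySpace hz (k ⟨n - 2, by omega⟩).natAbs)
  rw [mul_one, ← orders_last hn l k, sum_telescope _ hk] at h
  rw [orders_last hn] at h
  rw [funext (harmonicUnnormalized_eq hn l k hk)]
  exact h

end SphereSampling

end

/-! ### Exact recovery of the Fourier coefficients. -/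

theorem mainTheorem3 (n j : ℕ) (hn : 2 ≤ n) (hj : 1 ≤ j)
    (f : SphereSampling.Sphere n → ℂ) (hf : f ∈ SphereSampling.samplingSpace n j)
    (l : ℕ) (k : Fin (n - 1) → ℤ) (hlk : (l, k) ∈ SphereSampling.indexSet n j) :
    SphereSampling.fourierCoeff hn l k f =
      ((Real.pi / (2 ^ j * SphereSampling.sphereArea n) : ℝ) : ℂ) *
        ∑ st : SphereSampling.GridIndex n j,
          ((∏ ν : Fin (n - 1),
              SphereSampling.chiWeight (2 ^ j) (n - ((ν : ℕ) + 1)) (st.1 ν : ℕ) : ℝ) : ℂ) *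
            f (SphereSampling.gridPoint hn j st) *
            conj (SphereSampling.sphericalHarmonic hn l k
              (SphereSampling.gridPoint hn j st)) := by
  open SphereSampling in
  have hY : sphericalHarmonic hn l k ∈ polySpace n l :=
    Submodule.smul_mem _ _ (harmonicUnnormalized_mem_polySpace hn l k hlk.2.1)
  have hl : l < 2 ^ (j - 1) := hlk.1
  have h2 : 2 ^ j = 2 * 2 ^ (j - 1) := by rw [← pow_succ', Nat.sub_add_cancel hj]
  -- The degrees add up to at most `l + (2 ^ (j - 1) - 1)`, which is below `2 ^ j` because `l < 2 ^
  -- (j - 1)`.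
  have hprod := SphereSampling.polySpace_mono (e := 2 ^ j) (by omega)
    (SphereSampling.mul_mem_polySpace (SphereSampling.conj_mem_polySpace hY)
      (SphereSampling.samplingSpace_le_polySpace n j hf))
  have h := SphereSampling.grid_polynomial hn hj hprod
  rw [SphereSampling.fourierCoeff, SphereSampling.l2Inner, ← h, ← mul_assoc]
  congr 1
  · push_cast
    rw [div_mul_div_comm, one_mul, mul_comm]
  · exact Finset.sum_congr rfl fun st _ => by ring
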